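/- Let $\Lambda$ be an Artin algebra, i.e. a ring that is finitely generated as a module over a commutative artinian ring $R$ acting centrally, and let $\mathrm{mod}(\Lambda)$ be the category of finitely generated left $\Lambda$-modules. Projective and injective dimensions $\mathrm{pd}$, $\mathrm{id}$ take values in $\mathbb N\cup\{\infty\}$, the zero module having dimension $0$. Suppose that $\Lambda$ is $n$-Gorenstein, i.e. $\mathrm{id}({}_\Lambda\Lambda)$ and $\mathrm{id}(\Lambda_\Lambda)$ are both finite and $n=\mathrm{id}({}_\Lambda\Lambda)$ (it is well known that then also $n=\mathrm{id}(\Lambda_\Lambda)$). Then $$\mathrm{fin.dim}(\Lambda)=\Phi\mathrm{dim}(\Lambda)=\Psi\mathrm{dim}(\Lambda)=\mathrm{gl.Gpdim}(\Lambda)=n,$$ where the following notation is used. * For a class $\mathcal Z\subseteq\mathrm{mod}(\Lambda)$, $\mathrm{fin.dim}(\mathcal Z):=\sup\{\mathrm{pd}\,Z : Z\in\mathcal Z,\ \mathrm{pd}\,Z<\infty\}$, and $\mathrm{fin.dim}(\Lambda):=\mathrm{fin.dim}(\mathrm{mod}(\Lambda))$. * $\Omega M$ is the kernel of the projective cover of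 $M$. Let $K$ be the abelian group generated by the isomorphism classes $[M]$, $M\in\mathrm{mod}(\Lambda)$, modulo the relations $[M]=[X]+[Y]$ if $M\simeq X\oplus Y$, and $[P]=0$ if $P$ is projective; let $L:K\to K$ be the endomorphism $[M]\mapsto[\Omega M]$, and for $X\in\mathrm{mod}(\Lambda)$ let $\langle X\rangle\subseteq K$ be the subgroup generated by the classes of the indecomposable modules in $\mathrm{add}\,X$. Then $\Phi(X)$ is the least $k\ge 0$ such that $L: L^m\langle X\rangle\to L^{m+1}\langle X\rangle$ is an isomorphism for all $m\ge k$, and $\Psi(X):=\Phi(X)+\mathrm{fin.dim}(\{Z\in\mathrm{mod}(\Lambda) : Z \text{ is isomorphic to a direct summand of } \Omega^{\Phi(X)}X\})$. Further $\Phi\mathrm{dim}(\Lambda):=\sup_X\Phi(X)$ and $\Psi\mathrm{dim}(\Lambda):=\sup_X\Psi(X)$, over all $X\in\mathrm{mod}(\Lambda)$. * $M\in\mathrm{mod}(\Lambda)$ is Gorenstein projective if it is (isomorphic to) a kernel of a differential in an acyclic complex, indexed by $\mathbb Z$, of finitely generated projective $\Lambda$-modules that stays acyclic under $\mathrm{Hom}_\Lambda(-,Q)$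 for every finitely generated projective $Q$. $\mathrm{Gpd}(M)$ is the least $m\geq 0$ such that there is an exact sequence $0\to G_m\to\cdots\to G_0\to M\to 0$ with all $G_i\in\mathrm{mod}(\Lambda)$ Gorenstein projective ($\infty$ if there is none), and $\mathrm{gl.Gpdim}(\Lambda):=\sup\{\mathrm{Gpd}(M) : M\in\mathrm{mod}(\Lambda)\}$. -/

import Mathlib

open CategoryTheory

universe u v

noncomputable section

namespace HomDim

section Dimensions

variable {Λ : Type u} [Ring Λ]

/-- Projective dimension of a module, with the convention that the zero module has dimension `0`
(Mathlib's `projectiveDimension` is `⊥` there). -/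
def pd (M : ModuleCat.{u} Λ) : ℕ∞ := (projectiveDimension M).unbotD 0

/-- Injective dimension of a module, with the convention that the zero module has dimension `0`
(Mathlib's `injectiveDimension` is `⊥` there). -/
def injDim (M : ModuleCat.{u} Λ) : ℕ∞ := (injectiveDimension M).unbotD 0

/-- The finitistic dimension of a class `𝒳` of finitely generated modules:
the supremum of the finite projective dimensions of its members. -/
def finDimOf (𝒳 : Set (FGModuleCat.{u} Λ)) : ℕ∞ :=
  ⨆ X ∈ 𝒳, ⨆ (_ : pd X.obj ≠ ⊤), pd X.obj

variable (Λ) in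
/-- The (small, left) finitistic dimension of `Λ`. -/
def finDim : ℕ∞ := finDimOf (Set.univ : Set (FGModuleCat.{u} Λ))

/-- `M` is isomorphic to a direct summand of `N`. -/
def IsSummand (M N : FGModuleCat.{u} Λ) : Prop :=
  ∃ W : FGModuleCat.{u} Λ, Nonempty (N ≃ₗ[Λ] M × W)

/-- `M` belongs to `add X`: it is a direct summand of a finite direct sum of copies of `X`. -/
def InAdd (M X : FGModuleCat.{u} Λ) : Prop :=
  ∃ k : ℕ, IsSummand M (FGModuleCat.of Λ (Fin k → X))

/-- `M` is an indecomposable module. -/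
def IsIndecomposable (M : FGModuleCat.{u} Λ) : Prop :=
  Nontrivial M ∧ ∀ p q : Submodule Λ M, IsCompl p q → p = ⊥ ∨ q = ⊥

/-- `M` is a finitely generated Gorenstein projective module: it is a kernel in an exact complex
`⋯ → P (m + 2) → P (m + 1) → P m → ⋯` (`m : ℤ`) of finitely generated projective modules which
stays exact under `Hom(-, Q)` for every finitely generated projective `Q`. (By shifting the
indices, it does not matter which kernel is taken.) -/
def IsGorensteinProjective (M : FGModuleCat.{u} Λ) : Prop :=
  ∃ (P : ℤ → FGModuleCat.{u} Λ) (d : ∀ m : ℤ, P (m + 1) →ₗ[Λ] P m),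
    (∀ m, Module.Projective Λ (P m)) ∧
    (∀ m, Function.Exact (d (m + 1)) (d m)) ∧
    (∀ Q : FGModuleCat.{u} Λ, Module.Projective Λ Q → ∀ m,
      Function.Exact (fun φ : P m →ₗ[Λ] Q => φ ∘ₗ d m)
        (fun φ : P (m + 1) →ₗ[Λ] Q => φ ∘ₗ d (m + 1))) ∧
    Nonempty (M ≃ₗ[Λ] LinearMap.ker (d 0))

/-- `ResDimLE 𝒳 n M`: there is an exact sequence `0 → X_n → ⋯ → X_1 → X_0 → M → 0` with all
`X_i` in `𝒳`. Such a sequence is spliced from the short exact sequences `0 → K → X_0 → M → 0` and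
a sequence of the same kind for `K`, shorter by one. -/
inductive ResDimLE (𝒳 : Set (FGModuleCat.{u} Λ)) : ℕ → FGModuleCat.{u} Λ → Prop
  | zero (X M : FGModuleCat.{u} Λ) (hX : X ∈ 𝒳) (e : X ≃ₗ[Λ] M) : ResDimLE 𝒳 0 M
  | succ (n : ℕ) (K X M : FGModuleCat.{u} Λ) (hX : X ∈ 𝒳)
      (i : K →ₗ[Λ] X) (p : X →ₗ[Λ] M) (hi : Function.Injective i) (hip : Function.Exact i p)
      (hp : Function.Surjective p) (hK : ResDimLE 𝒳 n K) : ResDimLE 𝒳 (n + 1) M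

/-- The `𝒳`-resolution dimension of `M`: the least `n` with an exact sequence
`0 → X_n → ⋯ → X_0 → M → 0`, all `X_i` in `𝒳`, and `⊤` if there is none. -/
def resDim (𝒳 : Set (FGModuleCat.{u} Λ)) (M : FGModuleCat.{u} Λ) : ℕ∞ :=
  ⨅ (n : ℕ) (_ : ResDimLE 𝒳 n M), (n : ℕ∞)

/-- The Gorenstein projective dimension. -/
def gpd (M : FGModuleCat.{u} Λ) : ℕ∞ := resDim {X | IsGorensteinProjective X} M

variable (Λ) in
/-- The global Gorenstein projective dimension of `Λ`. -/
def glGpdim : ℕ∞ := ⨆ M : FGModuleCat.{u} Λ, gpd M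

variable (Λ) in
/-- `Λ` has finite injective dimension both as a left and as a right module over itself. -/
structure IsGorenstein : Prop where
  left_ne_top : injDim (ModuleCat.of Λ Λ) ≠ ⊤
  right_ne_top : injDim (ModuleCat.of Λᵐᵒᵖ Λ) ≠ ⊤

end Dimensions

section Syzygy

variable {Λ : Type u} [Ring Λ]

/-- `f : P → M` is a projective cover: an epimorphism from a projective module whose kernel is
superfluous. -/
structure IsProjectiveCover {P M : FGModuleCat.{u} Λ} (f : P →ₗ[Λ] M) : Prop where
  projective : Module.Projective Λ P
  surjective : Function.Surjective f
  superfluous : ∀ N : Submodule Λ P, N ⊔ LinearMap.ker f = ⊤ → N = ⊤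

variable [IsArtinianRing Λ]

theorem exists_projectiveCover (M : FGModuleCat.{u} Λ) :
    ∃ (P : FGModuleCat.{u} Λ) (f : P →ₗ[Λ] M), IsProjectiveCover f := by
  let S : Set (FGModuleCat.{u} Λ) :=
    {P | Module.Projective Λ P ∧ ∃ f : P →ₗ[Λ] M, Function.Surjective f}
  have hS : S.Nonempty := by
    obtain ⟨n, f, hf⟩ := Module.Finite.exists_fin' Λ M
    exact ⟨FGModuleCat.of Λ (Fin n → Λ),
      show Module.Projective Λ (Fin n → Λ) from inferInstance, f, hf⟩
  let len : FGModuleCat.{u} Λ → ℕ∞ := fun P => Module.length Λ P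
  obtain ⟨P, ⟨hP, f, hf⟩, hmin⟩ :=
    (InvImage.wf len (wellFounded_lt (α := ℕ∞))).has_min S hS
  refine ⟨P, f, hP, hf, fun N hN => ?_⟩
  have hsurj : Function.Surjective (f ∘ₗ N.subtype) := by
    rw [← LinearMap.range_eq_top, LinearMap.range_comp, Submodule.range_subtype]
    have h1 : (N ⊔ LinearMap.ker f).map f = N.map f := by
      rw [Submodule.map_sup]
      have : (LinearMap.ker f).map f = ⊥ := by
        exact LinearMap.le_ker_iff_map.mp le_rfl
      rw [this, sup_bot_eq]
    rw [← h1, hN, Submodule.map_top, LinearMap.range_eq_top.mpr hf]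
  obtain ⟨h, hh⟩ := Module.projective_lifting_property (f ∘ₗ N.subtype) f hsurj
  let g : Module.End Λ P := N.subtype ∘ₗ h
  have hg : f ∘ₗ g = f := hh
  have hgk : ∀ (k : ℕ) (x : P), f ((g ^ k) x) = f x := by
    intro k
    induction k with
    | zero => intro x; simp
    | succ k ih =>
      intro x
      rw [pow_succ, Module.End.mul_apply, ih]
      exact LinearMap.congr_fun hg x
  obtain ⟨k, hk⟩ := Filter.eventually_atTop.mp (LinearMap.eventually_isCompl_ker_pow_range_pow g)
  have hc := hk (k + 1) (Nat.le_succ k)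
  set Q := LinearMap.range (g ^ (k + 1)) with hQ
  have hQN : Q ≤ N := by
    rintro _ ⟨x, rfl⟩
    rw [pow_succ', Module.End.mul_apply]
    exact (h _).2
  by_contra hne
  have hlt : Q < ⊤ := lt_of_le_of_lt hQN (lt_top_iff_ne_top.mpr hne)
  have hQP : Module.Projective Λ Q := by
    refine Module.Projective.of_split Q.subtype (Q.projectionOnto _ hc.symm) ?_
    ext x
    simp
  refine hmin (FGModuleCat.of Λ Q) ⟨hQP, f ∘ₗ Q.subtype, ?_⟩ (Submodule.length_lt hlt.ne)
  intro m
  obtain ⟨x, hx⟩ := hf m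
  exact ⟨⟨(g ^ (k + 1)) x, ⟨x, rfl⟩⟩, (hgk (k + 1) x).trans hx⟩

/-- The projective cover of `M` (unique up to isomorphism). -/
def cover (M : FGModuleCat.{u} Λ) : FGModuleCat.{u} Λ := (exists_projectiveCover M).choose

/-- The projection from the projective cover. -/
def coverMap (M : FGModuleCat.{u} Λ) : cover M →ₗ[Λ] M :=
  (exists_projectiveCover M).choose_spec.choose

theorem isProjectiveCover_coverMap (M : FGModuleCat.{u} Λ) : IsProjectiveCover (coverMap M) :=
  (exists_projectiveCover M).choose_spec.choose_spec

/-- The syzygy `Ω M`, the kernel of the projective cover of `M`. -/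
def syzygy (M : FGModuleCat.{u} Λ) : FGModuleCat.{u} Λ :=
  FGModuleCat.of Λ (LinearMap.ker (coverMap M))

end Syzygy

section IgusaTodorov

variable (Λ : Type u) [Ring Λ]

/-- The relations `[M] = [X] + [Y]` for `M ≅ X ⊕ Y`, and `[P] = 0` for `P` projective. -/
def relations : Set (FreeAbelianGroup (FGModuleCat.{u} Λ)) :=
  {r | ∃ M X Y : FGModuleCat.{u} Λ, Nonempty (M ≃ₗ[Λ] X × Y) ∧
      r = FreeAbelianGroup.of M - FreeAbelianGroup.of X - FreeAbelianGroup.of Y} ∪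
  {r | ∃ P : FGModuleCat.{u} Λ, Module.Projective Λ P ∧ r = FreeAbelianGroup.of P}

/-- The abelian group generated by the symbols `[M]`, `M` a finitely generated module, subject to
`[M] = [X] + [Y]` for `M ≅ X ⊕ Y` and `[P] = 0` for `P` projective. (The relations for `Y = 0`
identify isomorphic modules.) -/
abbrev K₀ : Type (u + 1) :=
  FreeAbelianGroup (FGModuleCat.{u} Λ) ⧸ AddSubgroup.closure (relations Λ)

variable {Λ}

/-- The class `[M]`. -/
def cls (M : FGModuleCat.{u} Λ) : K₀ Λ := QuotientAddGroup.mk (FreeAbelianGroup.of M)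

theorem cls_eq_add {M X Y : FGModuleCat.{u} Λ} (e : M ≃ₗ[Λ] X × Y) : cls M = cls X + cls Y := by
  have h : FreeAbelianGroup.of M - FreeAbelianGroup.of X - FreeAbelianGroup.of Y ∈
      AddSubgroup.closure (relations Λ) :=
    AddSubgroup.subset_closure (Or.inl ⟨M, X, Y, ⟨e⟩, rfl⟩)
  have h' := (QuotientAddGroup.eq_zero_iff _).mpr h
  rw [QuotientAddGroup.mk_sub, QuotientAddGroup.mk_sub, sub_sub, sub_eq_zero] at h'
  exact h'

theorem cls_projective {P : FGModuleCat.{u} Λ} (hP : Module.Projective Λ P) : cls P = 0 :=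
  (QuotientAddGroup.eq_zero_iff _).mpr (AddSubgroup.subset_closure (Or.inr ⟨P, hP, rfl⟩))

theorem cls_congr {M N : FGModuleCat.{u} Λ} (e : M ≃ₗ[Λ] N) : cls M = cls N := by
  have h := cls_eq_add (M := M) (X := N) (Y := FGModuleCat.of Λ PUnit.{u + 1})
    (e.trans (LinearEquiv.prodUnique (R := Λ) (M := N) (M₂ := PUnit.{u + 1})).symm)
  rw [h, cls_projective (P := FGModuleCat.of Λ PUnit.{u + 1})
    (show Module.Projective Λ PUnit.{u + 1} from inferInstance), add_zero]

variable [IsArtinianRing Λ]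

theorem cls_of_surjective {E Q : FGModuleCat.{u} Λ} (hQ : Module.Projective Λ Q)
    (p : E →ₗ[Λ] Q) (hp : Function.Surjective p) :
    cls E = cls (FGModuleCat.of Λ (LinearMap.ker p)) := by
  obtain ⟨s, hs⟩ := Module.projective_lifting_property p LinearMap.id hp
  have e := (Function.Exact.splitSurjectiveEquiv (f := (LinearMap.ker p).subtype) (g := p)
    (by intro y; simp) (Submodule.subtype_injective _) ⟨s, hs⟩).1
  rw [cls_eq_add (M := E) (X := FGModuleCat.of Λ (LinearMap.ker p)) (Y := Q) e,
    cls_projective hQ, add_zero]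

/-- Schanuel's lemma: the class of the kernel of a projective presentation depends only on the
presented module. -/
theorem cls_ker_eq {P Q M : FGModuleCat.{u} Λ} (hP : Module.Projective Λ P)
    (hQ : Module.Projective Λ Q) (f : P →ₗ[Λ] M) (g : Q →ₗ[Λ] M) (hf : Function.Surjective f)
    (hg : Function.Surjective g) :
    cls (FGModuleCat.of Λ (LinearMap.ker f)) = cls (FGModuleCat.of Λ (LinearMap.ker g)) := by
  let E : Submodule Λ (P × Q) := LinearMap.eqLocus (f ∘ₗ LinearMap.fst Λ P Q)
    (g ∘ₗ LinearMap.snd Λ P Q)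
  have memE : ∀ x : P × Q, x ∈ E ↔ f x.1 = g x.2 := fun x => Iff.rfl
  let p₁ : E →ₗ[Λ] P := LinearMap.fst Λ P Q ∘ₗ E.subtype
  let p₂ : E →ₗ[Λ] Q := LinearMap.snd Λ P Q ∘ₗ E.subtype
  have h₁ : Function.Surjective p₁ := fun x => by
    obtain ⟨y, hy⟩ := hg (f x)
    exact ⟨⟨(x, y), hy.symm⟩, rfl⟩
  have h₂ : Function.Surjective p₂ := fun y => by
    obtain ⟨x, hx⟩ := hf (g y)
    exact ⟨⟨(x, y), hx⟩, rfl⟩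
  have e₁ : LinearMap.ker p₁ ≃ₗ[Λ] LinearMap.ker g :=
    LinearEquiv.ofBijective
      (LinearMap.codRestrict (LinearMap.ker g) (p₂ ∘ₗ (LinearMap.ker p₁).subtype) (by
        rintro ⟨⟨⟨x, y⟩, hxy⟩, hx⟩
        have hx' : x = 0 := hx
        have : f x = g y := hxy
        change g y = 0
        rw [← this, hx', map_zero]))
      ⟨by
        rintro ⟨⟨⟨x, y⟩, hxy⟩, hx⟩ ⟨⟨⟨x', y'⟩, hxy'⟩, hx'⟩ h
        have hx0 : x = 0 := hx
        have hx0' : x' = 0 := hx'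
        have hy : y = y' := congrArg Subtype.val h
        subst hx0 hx0' hy
        rfl,
      by
        rintro ⟨y, hy⟩
        have hy' : g y = 0 := hy
        exact ⟨⟨⟨(0, y), by rw [memE]; simp [hy']⟩, rfl⟩, rfl⟩⟩
  have e₂ : LinearMap.ker p₂ ≃ₗ[Λ] LinearMap.ker f :=
    LinearEquiv.ofBijective
      (LinearMap.codRestrict (LinearMap.ker f) (p₁ ∘ₗ (LinearMap.ker p₂).subtype) (by
        rintro ⟨⟨⟨x, y⟩, hxy⟩, hy⟩
        have hy' : y = 0 := hy
        have : f x = g y := hxy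
        change f x = 0
        rw [this, hy', map_zero]))
      ⟨by
        rintro ⟨⟨⟨x, y⟩, hxy⟩, hx⟩ ⟨⟨⟨x', y'⟩, hxy'⟩, hx'⟩ h
        have hy0 : y = 0 := hx
        have hy0' : y' = 0 := hx'
        have hxx : x = x' := congrArg Subtype.val h
        subst hy0 hy0' hxx
        rfl,
      by
        rintro ⟨x, hx⟩
        have hx' : f x = 0 := hx
        exact ⟨⟨⟨(x, 0), by rw [memE]; simp [hx']⟩, rfl⟩, rfl⟩⟩
  have a₁ := cls_of_surjective (E := FGModuleCat.of Λ E) hP p₁ h₁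
  have a₂ := cls_of_surjective (E := FGModuleCat.of Λ E) hQ p₂ h₂
  rw [cls_congr (M := FGModuleCat.of Λ (LinearMap.ker p₁))
    (N := FGModuleCat.of Λ (LinearMap.ker g)) e₁] at a₁
  rw [cls_congr (M := FGModuleCat.of Λ (LinearMap.ker p₂))
    (N := FGModuleCat.of Λ (LinearMap.ker f)) e₂] at a₂
  rw [← a₂, a₁]

theorem cls_syzygy {P M : FGModuleCat.{u} Λ} (hP : Module.Projective Λ P) (f : P →ₗ[Λ] M)
    (hf : Function.Surjective f) : cls (syzygy M) = cls (FGModuleCat.of Λ (LinearMap.ker f)) :=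
  cls_ker_eq (isProjectiveCover_coverMap M).projective hP (coverMap M) f
    (isProjectiveCover_coverMap M).surjective hf

/-- The product of two submodules, as a submodule of the product module, is their product. -/
def prodSubmoduleEquiv {A B : Type*} [AddCommGroup A] [AddCommGroup B] [Module Λ A] [Module Λ B]
    (p : Submodule Λ A) (q : Submodule Λ B) : p.prod q ≃ₗ[Λ] p × q where
  toFun x := (⟨x.1.1, x.2.1⟩, ⟨x.1.2, x.2.2⟩)
  invFun y := ⟨(y.1, y.2), y.1.2, y.2.2⟩
  map_add' _ _ := rfl
  map_smul' _ _ := rfl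
  left_inv _ := rfl
  right_inv _ := rfl

theorem cls_syzygy_add {M X Y : FGModuleCat.{u} Λ} (e : M ≃ₗ[Λ] X × Y) :
    cls (syzygy M) = cls (syzygy X) + cls (syzygy Y) := by
  have hX := isProjectiveCover_coverMap X
  have hY := isProjectiveCover_coverMap Y
  have := hX.projective
  have := hY.projective
  let f : (cover X × cover Y) →ₗ[Λ] M :=
    e.symm.toLinearMap ∘ₗ (coverMap X).prodMap (coverMap Y)
  have hf : Function.Surjective f :=
    e.symm.surjective.comp (Function.Surjective.prodMap hX.surjective hY.surjective)
  rw [cls_syzygy (P := FGModuleCat.of Λ (cover X × cover Y))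
    (show Module.Projective Λ (cover X × cover Y) from inferInstance) f hf]
  have hker : LinearMap.ker f = (LinearMap.ker (coverMap X)).prod (LinearMap.ker (coverMap Y)) := by
    rw [← LinearMap.ker_prodMap]
    exact LinearEquiv.ker_comp _ _
  exact cls_eq_add (M := FGModuleCat.of Λ (LinearMap.ker f)) (X := syzygy X) (Y := syzygy Y)
    ((LinearEquiv.ofEq _ _ hker).trans (prodSubmoduleEquiv _ _))

theorem cls_syzygy_projective {P : FGModuleCat.{u} Λ} (hP : Module.Projective Λ P) :
    cls (syzygy P) = 0 := by
  rw [cls_syzygy hP (LinearMap.id : P →ₗ[Λ] P) Function.surjective_id]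
  refine cls_projective ?_
  have : Subsingleton (LinearMap.ker (LinearMap.id : P →ₗ[Λ] P)) := by
    rw [LinearMap.ker_id]
    infer_instance
  exact (inferInstance : Module.Projective Λ (LinearMap.ker (LinearMap.id : P →ₗ[Λ] P)))

variable (Λ) in
/-- The endomorphism `[M] ↦ [Ω M]` of `K₀ Λ`. -/
def syzygyHom : K₀ Λ →+ K₀ Λ :=
  QuotientAddGroup.lift (AddSubgroup.closure (relations Λ))
    (FreeAbelianGroup.lift fun M => cls (syzygy M)) (by
      rw [AddSubgroup.closure_le]
      rintro _ (⟨M, X, Y, ⟨e⟩, rfl⟩ | ⟨P, hP, rfl⟩)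
      · rw [SetLike.mem_coe, AddMonoidHom.mem_ker, map_sub, map_sub]
        simp only [FreeAbelianGroup.lift_apply_of]
        rw [cls_syzygy_add e]
        abel
      · rw [SetLike.mem_coe, AddMonoidHom.mem_ker, FreeAbelianGroup.lift_apply_of]
        exact cls_syzygy_projective hP)

theorem syzygyHom_cls (M : FGModuleCat.{u} Λ) : syzygyHom Λ (cls M) = cls (syzygy M) :=
  FreeAbelianGroup.lift_apply_of _ _

/-- The subgroup `⟨X⟩` generated by the classes of the indecomposable modules in `add X`. -/
def addSubgroupOf (X : FGModuleCat.{u} Λ) : AddSubgroup (K₀ Λ) :=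
  AddSubgroup.closure {c | ∃ M : FGModuleCat.{u} Λ, IsIndecomposable M ∧ InAdd M X ∧ c = cls M}

/-- For an endomorphism `f` and a subgroup `X` of an abelian group: the least `k` such that `f`
restricts to an isomorphism `f ^ m (X) → f ^ (m + 1) (X)` for all `m ≥ k`. Such a `k` exists by
Fitting's lemma if `X` is finitely generated. -/
def fittingIndex {G : Type*} [AddCommGroup G] (f : G →+ G) (X : AddSubgroup G) : ℕ :=
  sInf {k : ℕ | ∀ m, k ≤ m → Set.BijOn f (f^[m] '' X) (f^[m + 1] '' X)}

/-- The Igusa-Todorov function `Φ`. -/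
def Phi (X : FGModuleCat.{u} Λ) : ℕ := fittingIndex (syzygyHom Λ) (addSubgroupOf X)

/-- The Igusa-Todorov function `Ψ`: `Ψ(X) = Φ(X) + fin.dim {Z | Z a summand of Ω^Φ(X) X}`. -/
def Psi (X : FGModuleCat.{u} Λ) : ℕ∞ :=
  Phi X + finDimOf {Z | IsSummand Z (syzygy^[Phi X] X)}

variable (Λ) in
/-- The `Φ`-dimension of `Λ`. -/
def PhiDim : ℕ∞ := ⨆ X : FGModuleCat.{u} Λ, (Phi X : ℕ∞)

variable (Λ) in
/-- The `Ψ`-dimension of `Λ`. -/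
def PsiDim : ℕ∞ := ⨆ X : FGModuleCat.{u} Λ, Psi X

end IgusaTodorov

end HomDim

end

/-! Everything is read off from the groups Ext^i(-, Λ), which vanish for i > n because id(Λ) = n on
the left.

Upper bounds. A finitely generated module of finite projective dimension d ≥ 1 has Ext^d(M, Λ) ≠ 0
(`pdLT_of_extZero`), so fin.dim ≤ n. If Ext^1(M, Λ) = 0, then ΩM → P(M) is a left approximation by a
projective, with cokernel M. Cokernels of left approximations define an endomorphism of K, which
therefore undoes L on the classes of such M (`cosyzygyHom_cls_syzygy`). All Ω^m M with m ≥ n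
qualify, whence Φ ≤ n. Summands of Ω^Φ(X) X have no Ext into Λ above degree n - Φ(X), so Ψ ≤ n.
Finite right injective dimension makes modules in `Perp` torsionless (`Perp.torsionless`); they then
embed in free modules with cokernel in `Perp`, so they are Gorenstein projective and Gpd ≤ n.

Lower bounds, for n ≥ 1. By Baer's criterion some M has Ext^n(M, Λ) ≠ 0. An Auslander–Buchweitz
embedding M → H with pd H ≤ n and cokernel in `Perp` transfers this to Ext^n(H, Λ) ≠ 0, and this one
H serves all invariants. It forces pd H ≥ n and Gpd H ≥ n. If Φ(H) < n, then injectivity of L and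
[Ω^n H] = 0 give [Ω^(n-1) H] = 0, so Ω^(n-1) H is projective, which contradicts Ext^n(H, Λ) ≠ 0.
That only projectives have class zero is detected by lengths of stable Hom modules, without
Krull–Schmidt. -/

noncomputable section

namespace HomDim

/-! ### Vanishing of Ext: long exact sequences and dimension shifting -/

section ExtVanishing

open Abelian

variable (S : Type u) [Ring S]

/-- `Ext^i(M, N) = 0`. -/
def ExtZero (i : ℕ) (M N : Type u) [AddCommGroup M] [Module S M] [AddCommGroup N] [Module S N] :
    Prop :=
  Subsingleton (Ext.{u} (ModuleCat.of S M) (ModuleCat.of S N) i)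

variable {S}
variable {A B C N : Type u} [AddCommGroup A] [Module S A] [AddCommGroup B] [Module S B]
  [AddCommGroup C] [Module S C] [AddCommGroup N] [Module S N]

/-- The short complex of modules attached to an exact pair of linear maps. -/
abbrev shortComplexOf (i : A →ₗ[S] B) (p : B →ₗ[S] C) (hip : Function.Exact i p) :
    ShortComplex (ModuleCat.{u} S) :=
  ModuleCat.shortComplexOfCompEqZero i p hip.linearMap_comp_eq_zero

theorem shortExact_of {i : A →ₗ[S] B} {p : B →ₗ[S] C} (hi : Function.Injective i)
    (hip : Function.Exact i p) (hp : Function.Surjective p) :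
    (shortComplexOf i p hip).ShortExact :=
  ModuleCat.shortComplex_shortExact _ hip hi hp

theorem extZero_iff {i : ℕ} :
    ExtZero S i A N ↔ ∀ e : Ext.{u} (ModuleCat.of S A) (ModuleCat.of S N) i, e = 0 :=
  ⟨fun h _ => h.elim _ _, fun h => ⟨fun a b => (h a).trans (h b).symm⟩⟩

theorem ExtZero.of_projective [Module.Projective S A] (i : ℕ) : ExtZero S (i + 1) A N :=
  extZero_iff.mpr fun e => e.eq_zero_of_projective

theorem ExtZero.of_split (s : A →ₗ[S] B) (r : B →ₗ[S] A) (hrs : r ∘ₗ s = LinearMap.id) {i : ℕ}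
    (h : ExtZero S i B N) : ExtZero S i A N := by
  rw [extZero_iff] at h ⊢
  intro e
  have h1 : ModuleCat.ofHom s ≫ ModuleCat.ofHom r = 𝟙 (ModuleCat.of S A) := by
    rw [← ModuleCat.ofHom_comp, hrs]; rfl
  rw [← e.mk₀_id_comp, ← h1, ← Ext.mk₀_comp_mk₀, Ext.comp_assoc_of_second_deg_zero,
    h ((Ext.mk₀ _).comp e (zero_add i)),
    Ext.comp_zero]

theorem ExtZero.of_equiv (e : A ≃ₗ[S] B) {i : ℕ} (h : ExtZero S i A N) : ExtZero S i B N :=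
  h.of_split e.symm.toLinearMap e.toLinearMap (by ext; simp)

section ShortExact

variable {f : A →ₗ[S] B} {g : B →ₗ[S] C} (hf : Function.Injective f) (hfg : Function.Exact f g)
  (hg : Function.Surjective g)
include hf hfg hg

theorem ExtZero.middle {i : ℕ} (hA : ExtZero S i A N) (hC : ExtZero S i C N) :
    ExtZero S i B N := by
  rw [extZero_iff] at hA hC ⊢
  intro e
  obtain ⟨x, rfl⟩ := Ext.contravariant_sequence_exact₂ (shortExact_of hf hfg hg) _ e (hA _)
  rw [hC x, Ext.comp_zero]

theorem ExtZero.left {i : ℕ} (hB : ExtZero S i B N) (hC : ExtZero S (i + 1) C N) :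
    ExtZero S i A N := by
  rw [extZero_iff] at hB hC ⊢
  intro e
  obtain ⟨x, rfl⟩ := Ext.contravariant_sequence_exact₁ (shortExact_of hf hfg hg) _ e
    (add_comm 1 i) (hC _)
  rw [hB x, Ext.comp_zero]

theorem ExtZero.right {i : ℕ} (hA : ExtZero S i A N) (hB : ExtZero S (i + 1) B N) :
    ExtZero S (i + 1) C N := by
  rw [extZero_iff] at hA hB ⊢
  intro e
  obtain ⟨x, rfl⟩ := Ext.contravariant_sequence_exact₃ (shortExact_of hf hfg hg) _ e (hB _)
    (add_comm 1 i)
  rw [hA x, Ext.comp_zero]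

theorem ExtZero.succ_iff [Module.Projective S B] {i : ℕ} :
    ExtZero S (i + 1) A N ↔ ExtZero S (i + 2) C N :=
  ⟨fun h => h.right hf hfg hg (.of_projective _), fun h => .left hf hfg hg (.of_projective _) h⟩

theorem ExtZero.exists_extension (h : ExtZero S 1 C N) (φ : A →ₗ[S] N) :
    ∃ ψ : B →ₗ[S] N, ψ ∘ₗ f = φ := by
  rw [extZero_iff] at h
  obtain ⟨x, hx⟩ := Ext.contravariant_sequence_exact₁ (shortExact_of hf hfg hg) (ModuleCat.of S N)
    (Ext.mk₀ (ModuleCat.ofHom φ)) (add_comm 1 0) (h _)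
  obtain ⟨ψ, rfl⟩ := Ext.homEquiv₀.symm.surjective x
  refine ⟨ψ.hom, ?_⟩
  have h2 : ModuleCat.ofHom f ≫ ψ = ModuleCat.ofHom φ :=
    Ext.homEquiv₀.symm.injective (by simpa using hx)
  exact congrArg ModuleCat.Hom.hom h2

theorem ExtZero.of_exists_extension [Module.Projective S B]
    (h : ∀ φ : A →ₗ[S] N, ∃ ψ : B →ₗ[S] N, ψ ∘ₗ f = φ) : ExtZero S 1 C N := by
  rw [extZero_iff]
  intro e
  have hS := shortExact_of hf hfg hg
  obtain ⟨x, rfl⟩ := Ext.contravariant_sequence_exact₃ hS _ e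
    (Ext.eq_zero_of_projective _) (add_comm 1 0)
  obtain ⟨φ, rfl⟩ := Ext.homEquiv₀.symm.surjective x
  obtain ⟨ψ, hψ⟩ := h φ.hom
  have h2 : φ = (shortComplexOf f g hfg).f ≫ ModuleCat.ofHom ψ := by
    rw [← ModuleCat.ofHom_hom φ, ← hψ]; rfl
  rw [h2]
  simp only [Ext.homEquiv₀_symm_apply]
  rw [← Ext.mk₀_comp_mk₀, ShortComplex.ShortExact.extClass_comp_assoc]

end ShortExact

/-- If `Ext^{n+1}(S/I, N) = 0` for all ideals `I` then `N` has injective dimension at most `n`. -/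
theorem hasInjectiveDimensionLT_of_extZero_quotient (n : ℕ) :
    ∀ (N : ModuleCat.{u} S), (∀ I : Ideal S, ExtZero S (n + 1) (S ⧸ I) N) →
      HasInjectiveDimensionLT N (n + 1) := by
  induction n with
  | zero =>
    intro N h
    have hB : Module.Baer S N := by
      intro I φ
      obtain ⟨ψ, hψ⟩ := (h I).exists_extension (f := I.subtype) (g := I.mkQ)
        I.subtype_injective (by intro x; simp) I.mkQ_surjective φ
      exact ⟨ψ, fun x hx => by rw [← hψ]; rfl⟩
    have := hB.injective
    have : Injective N := Module.injective_object_of_injective_module S N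
    infer_instance
  | succ n ih =>
    intro N h
    -- Shift in the second variable: replace N by the cokernel of an embedding into an injective.
    let ⟨J⟩ := EnoughInjectives.presentation N
    have hS : (ShortComplex.mk _ _ (Limits.cokernel.condition J.f)).ShortExact :=
      { exact := ShortComplex.exact_cokernel J.f }
    refine hS.hasInjectiveDimensionLT_X₁ (n + 1) (ih _ fun I => ?_) ?_
    · rw [extZero_iff]
      intro e
      obtain ⟨x, rfl⟩ := Ext.covariant_sequence_exact₃ _ hS e rfl ((extZero_iff.mp (h I)) _)
      rw [Ext.eq_zero_of_injective x, Ext.zero_comp]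
    · have : Injective J.J := inferInstance
      exact hasInjectiveDimensionLT_of_ge _ 1 _ (by omega)

theorem ExtZero.of_hasInjectiveDimensionLT {N : ModuleCat.{u} S} (n : ℕ)
    [HasInjectiveDimensionLT N n] {i : ℕ} (hi : n ≤ i) : ExtZero S i A N :=
  extZero_iff.mpr fun e => e.eq_zero_of_hasInjectiveDimensionLT n hi

theorem ExtZero.of_hasProjectiveDimensionLT {M : ModuleCat.{u} S} (n : ℕ)
    [HasProjectiveDimensionLT M n] {i : ℕ} (hi : n ≤ i) : ExtZero S i M N :=
  extZero_iff.mpr fun e => e.eq_zero_of_hasProjectiveDimensionLT n hi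

end ExtVanishing

/-! ### Duality Hom(-, Λ) on modules with no higher Ext into Λ -/

section Duality

variable (Λ : Type u) [Ring Λ]

/-- `Ext^i(M, Λ) = 0` for all `i ≥ 1`. -/
def Perp (M : Type u) [AddCommGroup M] [Module Λ M] : Prop := ∀ i : ℕ, ExtZero Λ (i + 1) M Λ

variable {Λ}
variable {A B C : Type u} [AddCommGroup A] [Module Λ A] [AddCommGroup B] [Module Λ B]
  [AddCommGroup C] [Module Λ C]

theorem Perp.of_equiv (e : A ≃ₗ[Λ] B) (h : Perp Λ A) : Perp Λ B := fun i => (h i).of_equiv e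

theorem Perp.of_projective [Module.Projective Λ A] : Perp Λ A := fun i => .of_projective i

theorem Perp.kernel {f : A →ₗ[Λ] B} {g : B →ₗ[Λ] C} [Module.Projective Λ B]
    (hf : Function.Injective f) (hfg : Function.Exact f g) (hg : Function.Surjective g)
    (h : Perp Λ C) : Perp Λ A :=
  fun i => (ExtZero.succ_iff hf hfg hg).mpr (h (i + 1))

/-- Degree 1 is the extension property of functionals; higher degrees come from `A` by dimension
shifting. -/
theorem Perp.cokernel {f : A →ₗ[Λ] B} {g : B →ₗ[Λ] C} [Module.Projective Λ B]
    (hf : Function.Injective f) (hfg : Function.Exact f g) (hg : Function.Surjective g)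
    (h : Perp Λ A) (hext : ∀ φ : A →ₗ[Λ] Λ, ∃ ψ : B →ₗ[Λ] Λ, ψ ∘ₗ f = φ) : Perp Λ C := by
  rintro (_ | i)
  · exact .of_exists_extension hf hfg hg hext
  · exact (ExtZero.succ_iff hf hfg hg).mp (h i)

theorem exists_factor {q : A →ₗ[Λ] B} (hq : Function.Surjective q) (ψ : A →ₗ[Λ] C)
    (h : ∀ x, q x = 0 → ψ x = 0) : ∃ g : B →ₗ[Λ] C, g ∘ₗ q = ψ := by
  refine ⟨(LinearMap.ker q).liftQ ψ h ∘ₗ (q.quotKerEquivOfSurjective hq).symm.toLinearMap, ?_⟩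
  ext x
  have : (q.quotKerEquivOfSurjective hq).symm (q x) = Submodule.Quotient.mk x := by
    rw [LinearEquiv.symm_apply_eq]; rfl
  simp only [LinearMap.comp_apply, LinearEquiv.coe_coe, this]
  rfl

/-- The transpose `Hom(B, Λ) → Hom(A, Λ)` of a linear map, as a map of right modules. -/
def transpose (f : A →ₗ[Λ] B) : (B →ₗ[Λ] Λ) →ₗ[Λᵐᵒᵖ] (A →ₗ[Λ] Λ) where
  toFun φ := φ ∘ₗ f
  map_add' _ _ := rfl
  map_smul' _ _ := rfl

@[simp] theorem transpose_apply (f : A →ₗ[Λ] B) (φ : B →ₗ[Λ] Λ) (x : A) :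
    transpose f φ x = φ (f x) := rfl

theorem transpose_injective {g : B →ₗ[Λ] C} (hg : Function.Surjective g) :
    Function.Injective (transpose g) := by
  intro φ ψ h
  ext x
  obtain ⟨y, rfl⟩ := hg x
  exact LinearMap.congr_fun h y

theorem transpose_exact {f : A →ₗ[Λ] B} {g : B →ₗ[Λ] C} (hfg : Function.Exact f g)
    (hg : Function.Surjective g) : Function.Exact (transpose g) (transpose f) := by
  intro φ
  constructor
  · intro h
    refine exists_factor hg φ fun x hx => ?_
    obtain ⟨y, rfl⟩ := (hfg x).mp hx
    exact LinearMap.congr_fun h y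
  · rintro ⟨ψ, rfl⟩
    ext x
    simp [hfg.apply_apply_eq_zero]

theorem transpose_surjective {f : A →ₗ[Λ] B} {g : B →ₗ[Λ] C} (hf : Function.Injective f)
    (hfg : Function.Exact f g) (hg : Function.Surjective g) (h : ExtZero Λ 1 C Λ) :
    Function.Surjective (transpose f) :=
  fun φ => h.exists_extension hf hfg hg φ

/-- The right regular module is free. -/
def unopLinearEquiv : Λᵐᵒᵖ ≃ₗ[Λᵐᵒᵖ] Λ :=
  { MulOpposite.opAddEquiv.symm with map_smul' := fun _ _ => rfl }

instance : Module.Free Λᵐᵒᵖ Λ := .of_equiv unopLinearEquiv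

instance projective_dual_pi (k : ℕ) : Module.Projective Λᵐᵒᵖ ((Fin k → Λ) →ₗ[Λ] Λ) :=
  .of_equiv ((Pi.basisFun Λ (Fin k)).constr Λᵐᵒᵖ)

/-- A functional on the dual of a free module of finite rank is an evaluation. -/
theorem exists_eq_eval {k : ℕ} (θ : ((Fin k → Λ) →ₗ[Λ] Λ) →ₗ[Λᵐᵒᵖ] Λ) :
    ∃ q : Fin k → Λ, ∀ φ, θ φ = φ q := by
  refine ⟨fun i => θ (LinearMap.proj i), fun φ => ?_⟩
  -- The coordinate functionals generate the dual as a right module, with coefficients the values on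
  -- the standard basis.
  have h : φ = ∑ i, MulOpposite.op (φ fun j => if i = j then 1 else 0) •
      LinearMap.proj (R := Λ) (φ := fun _ : Fin k => Λ) i := by
    ext x
    simpa using LinearMap.pi_apply_eq_sum_univ φ (Pi.single x 1)
  conv_lhs => rw [h]
  conv_rhs => rw [LinearMap.pi_apply_eq_sum_univ φ]
  simp

theorem Perp.ker {f : A →ₗ[Λ] B} [Module.Projective Λ A] (hf : Function.Surjective f)
    (h : Perp Λ B) : Perp Λ (LinearMap.ker f) :=
  h.kernel (LinearMap.ker f).subtype_injective (by intro x; simp) hf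

theorem exact_subtype_ker (f : A →ₗ[Λ] B) : Function.Exact (LinearMap.ker f).subtype f := by
  intro x; simp

/-- For Y in `Perp`, a presentation 0 → K → Λ^k → Y → 0 dualises to an exact sequence ending in K*.
Hence Ext^(i+1)(Y*, Λ) ≅ Ext^(i+2)(K*, Λ), and K is again in `Perp`. After `j` such shifts the
degree exceeds the right injective dimension. -/
theorem Perp.dual_extZero [IsNoetherianRing Λ] {m : ℕ}
    [HasInjectiveDimensionLT (ModuleCat.of Λᵐᵒᵖ Λ) m] (j : ℕ) :
    ∀ (i : ℕ), m ≤ i + j → ∀ (Y : Type u) [AddCommGroup Y] [Module Λ Y] [Module.Finite Λ Y],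
      Perp Λ Y → ExtZero Λᵐᵒᵖ (i + 1) (Y →ₗ[Λ] Λ) Λ := by
  induction j with
  | zero =>
    intro i hi Y _ _ _ _
    exact ExtZero.of_hasInjectiveDimensionLT (N := ModuleCat.of Λᵐᵒᵖ Λ) m (by omega)
  | succ j ih =>
    intro i hi Y _ _ _ hY
    obtain ⟨k, π, hπ⟩ := Module.Finite.exists_fin' Λ Y
    have hK := ih (i + 1) (by omega) (LinearMap.ker π) (hY.ker hπ)
    exact (ExtZero.succ_iff (transpose_injective hπ) (transpose_exact (exact_subtype_ker π) hπ)
      (transpose_surjective (Submodule.subtype_injective _) (exact_subtype_ker π) hπ (hY 0))).mpr hK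

/-- Over a noetherian ring of finite right self-injective dimension, a module in `Perp` is
torsionless. -/
theorem Perp.torsionless [IsNoetherianRing Λ] {m : ℕ}
    [HasInjectiveDimensionLT (ModuleCat.of Λᵐᵒᵖ Λ) m] {X : Type u} [AddCommGroup X] [Module Λ X]
    [Module.Finite Λ X] (hX : Perp Λ X) (x : X) (hx : ∀ φ : X →ₗ[Λ] Λ, φ x = 0) : x = 0 := by
  obtain ⟨k, π, hπ⟩ := Module.Finite.exists_fin' Λ X
  obtain ⟨l, ρ, hρ⟩ := Module.Finite.exists_fin' Λ (LinearMap.ker π)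
  have hK := hX.ker hπ
  have hK' := hK.ker hρ
  obtain ⟨p, rfl⟩ := hπ x
  -- Evaluation at a lift `p` of x kills X*, so it descends to K*. It then extends to the dual of a
  -- free cover of K, where it is evaluation at some `q`. Comparing coordinates puts `p` in K.
  let ev : ((Fin k → Λ) →ₗ[Λ] Λ) →ₗ[Λᵐᵒᵖ] Λ :=
    { toFun := fun φ => φ p, map_add' := fun _ _ => rfl, map_smul' := fun _ _ => rfl }
  let τ := transpose (LinearMap.ker π).subtype
  have hτ : Function.Surjective τ :=
    transpose_surjective (Submodule.subtype_injective _) (exact_subtype_ker π) hπ (hX 0)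
  obtain ⟨θ, hθ⟩ := exists_factor hτ ev fun φ hφ => by
    obtain ⟨ψ, rfl⟩ := (transpose_exact (exact_subtype_ker π) hπ φ).mp hφ
    exact hx ψ
  obtain ⟨θ', hθ'⟩ := (Perp.dual_extZero (m := m) m 0 (by omega) _ hK').exists_extension
    (transpose_injective hρ) (transpose_exact (exact_subtype_ker ρ) hρ)
    (transpose_surjective (Submodule.subtype_injective _) (exact_subtype_ker ρ) hρ (hK 0)) θ
  obtain ⟨q, hq⟩ := exists_eq_eval θ'
  have hpq : p = (ρ q : Fin k → Λ) := by
    funext i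
    have h1 := LinearMap.congr_fun hθ (LinearMap.proj i)
    rw [← hθ', LinearMap.comp_apply, LinearMap.comp_apply, hq] at h1
    exact h1.symm
  rw [hpq]
  exact (ρ q).2

end Duality

/-! ### Left approximations by free modules -/

section Approximations

variable {Λ : Type u} [Ring Λ]
variable {A B C F G Q : Type u} [AddCommGroup A] [Module Λ A] [AddCommGroup B] [Module Λ B]
  [AddCommGroup C] [Module Λ C] [AddCommGroup F] [Module Λ F] [AddCommGroup G] [Module Λ G]
  [AddCommGroup Q] [Module Λ Q]

/-- Every functional on `A` factors through `f`. -/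
def IsLeftApprox (f : A →ₗ[Λ] F) : Prop := ∀ φ : A →ₗ[Λ] Λ, ∃ ψ : F →ₗ[Λ] Λ, ψ ∘ₗ f = φ

/-- Testing against Λ suffices, since `Q` is a retract of some Λ^k and maps into Λ^k extend
coordinatewise. -/
theorem IsLeftApprox.exists_extension [Module.Finite Λ Q] [Module.Projective Λ Q] {f : A →ₗ[Λ] F}
    (hf : IsLeftApprox f) (φ : A →ₗ[Λ] Q) : ∃ ψ : F →ₗ[Λ] Q, ψ ∘ₗ f = φ := by
  obtain ⟨k, π, hπ⟩ := Module.Finite.exists_fin' Λ Q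
  obtain ⟨s, hs⟩ := Module.projective_lifting_property π LinearMap.id hπ
  choose ψ hψ using fun i => hf (LinearMap.proj i ∘ₗ s ∘ₗ φ)
  refine ⟨π ∘ₗ LinearMap.pi ψ, ?_⟩
  ext x
  have h1 : LinearMap.pi ψ (f x) = s (φ x) := by
    ext i
    exact LinearMap.congr_fun (hψ i) x
  rw [LinearMap.comp_apply, LinearMap.comp_apply, h1]
  exact LinearMap.congr_fun hs (φ x)

/-- M* embeds in the dual of a free module of finite rank, so it is a finitely generated right
module; take generators as the components of `f`. -/
theorem exists_isLeftApprox [IsNoetherianRing Λᵐᵒᵖ] (M : Type u) [AddCommGroup M] [Module Λ M]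
    [Module.Finite Λ M] : ∃ (k : ℕ) (f : M →ₗ[Λ] (Fin k → Λ)), IsLeftApprox f := by
  obtain ⟨l, π, hπ⟩ := Module.Finite.exists_fin' Λ M
  have h1 : Module.Finite Λᵐᵒᵖ Λ := .of_surjective unopLinearEquiv.toLinearMap
    unopLinearEquiv.surjective
  have h2 : IsNoetherian Λᵐᵒᵖ ((Fin l → Λ) →ₗ[Λ] Λ) :=
    isNoetherian_of_linearEquiv ((Pi.basisFun Λ (Fin l)).constr Λᵐᵒᵖ)
  have h3 : IsNoetherian Λᵐᵒᵖ (M →ₗ[Λ] Λ) :=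
    isNoetherian_of_injective (transpose π) (transpose_injective hπ)
  obtain ⟨k, g, hg⟩ := Module.Finite.exists_fin (R := Λᵐᵒᵖ) (M := M →ₗ[Λ] Λ)
  refine ⟨k, LinearMap.pi g, fun φ => ?_⟩
  have hφ : φ ∈ Submodule.span Λᵐᵒᵖ (Set.range g) := hg ▸ Submodule.mem_top
  obtain ⟨c, rfl⟩ := (Submodule.mem_span_range_iff_exists_fun _).mp hφ
  refine ⟨∑ i, c i • LinearMap.proj i, ?_⟩
  ext x
  simp

theorem Perp.isLeftApprox {f : A →ₗ[Λ] B} {g : B →ₗ[Λ] C} (hf : Function.Injective f)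
    (hfg : Function.Exact f g) (hg : Function.Surjective g) (h : Perp Λ C) : IsLeftApprox f :=
  (h 0).exists_extension hf hfg hg

/-- Over a noetherian ring of finite right self-injective dimension, a module in `Perp` embeds
into a free module with cokernel in `Perp`. -/
theorem Perp.exists_cosyzygy [IsNoetherianRing Λ] [IsNoetherianRing Λᵐᵒᵖ] {m : ℕ}
    [HasInjectiveDimensionLT (ModuleCat.of Λᵐᵒᵖ Λ) m] {X : Type u} [AddCommGroup X] [Module Λ X]
    [Module.Finite Λ X] (hX : Perp Λ X) :
    ∃ (k : ℕ) (f : X →ₗ[Λ] (Fin k → Λ)), Function.Injective f ∧ IsLeftApprox f ∧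
      Perp Λ ((Fin k → Λ) ⧸ LinearMap.range f) := by
  obtain ⟨k, f, hf⟩ := exists_isLeftApprox (Λ := Λ) X
  have hinj : Function.Injective f := by
    rw [← LinearMap.ker_eq_bot, LinearMap.ker_eq_bot']
    intro x hx
    refine hX.torsionless (m := m) x fun φ => ?_
    obtain ⟨ψ, rfl⟩ := hf φ
    rw [LinearMap.comp_apply, hx, map_zero]
  exact ⟨k, f, hinj, hf, hX.cokernel hinj (LinearMap.exact_map_mkQ_range f)
    (Submodule.mkQ_surjective _) hf⟩

end Approximations

/-! ### Gorenstein projectives are exactly the modules in `Perp` -/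

section GorensteinProjective

variable {Λ : Type u} [Ring Λ]

theorem exists_int_chain {α : Type*} (r : α → α → Prop) (hs : ∀ a, ∃ b, r b a)
    (ht : ∀ a, ∃ b, r a b) (a : α) (k : ℤ) : ∃ X : ℤ → α, X k = a ∧ ∀ m, r (X (m + 1)) (X m) := by
  choose s hs using hs
  choose t ht using ht
  let Y : ℤ → α := fun m =>
    match m with
    | Int.ofNat k => s^[k] a
    | Int.negSucc k => t^[k + 1] a
  have hY : ∀ m, r (Y (m + 1)) (Y m) := by
    rintro (k | _ | k)
    · change r (s^[k + 1] a) (s^[k] a)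
      rw [Function.iterate_succ_apply']
      exact hs _
    · exact ht a
    · change r (t^[k + 1] a) (t^[k + 2] a)
      rw [Function.iterate_succ_apply' t (k + 1)]
      exact ht _
  refine ⟨fun m => Y (m - k), by simp [Y], fun m => ?_⟩
  change r (Y (m + 1 - k)) (Y (m - k))
  rw [show m + 1 - k = (m - k) + 1 by ring]
  exact hY _

/-- There is a short exact sequence `0 → Y → P → X → 0` with `P` projective such that every
functional on `Y` extends to `P`. -/
def IsTightSyzygy (Y X : FGModuleCat.{u} Λ) : Prop :=
  ∃ (P : FGModuleCat.{u} Λ) (i : Y →ₗ[Λ] P) (p : P →ₗ[Λ] X), Module.Projective Λ P ∧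
    Function.Injective i ∧ Function.Exact i p ∧ Function.Surjective p ∧ IsLeftApprox i

/-- Splice 0 → X (m+1) → P m → X m → 0 into one complex. The differential out of `P 1` factors
through `X 1`, so its kernel is `X 2`; this fixes the index. -/
theorem isGorensteinProjective_of_chain (X : ℤ → FGModuleCat.{u} Λ)
    (hX : ∀ m, IsTightSyzygy (X (m + 1)) (X m)) : IsGorensteinProjective (X 2) := by
  choose P i p hP hi hip hp happ using hX
  refine ⟨P, fun m => i m ∘ₗ p (m + 1), hP, fun m y => ?_, fun Q hQ m φ => ?_, ?_⟩
  · simp only [LinearMap.comp_apply]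
    rw [map_eq_zero_iff _ (hi m), hip (m + 1) y]
    constructor
    · rintro ⟨x, rfl⟩
      obtain ⟨z, rfl⟩ := hp (m + 1 + 1) x
      exact ⟨z, rfl⟩
    · rintro ⟨z, rfl⟩
      exact ⟨_, rfl⟩
  · constructor
    · intro h
      have h1 : φ ∘ₗ i (m + 1) = 0 := by
        ext x
        obtain ⟨z, rfl⟩ := hp (m + 1 + 1) x
        exact LinearMap.congr_fun h z
      obtain ⟨χ, hχ⟩ := exists_factor (hp (m + 1)) φ fun x hx => by
        obtain ⟨y, rfl⟩ := (hip (m + 1) x).mp hx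
        exact LinearMap.congr_fun h1 y
      obtain ⟨ψ, hψ⟩ := (happ m).exists_extension χ
      refine ⟨ψ, ?_⟩
      rw [← hχ, ← hψ]
      rfl
    · rintro ⟨ψ, rfl⟩
      ext x
      have : p (m + 1) (i (m + 1) (p (m + 1 + 1) x)) = 0 := (hip (m + 1)).apply_apply_eq_zero _
      simp [this]
  · have h : LinearMap.ker (i 0 ∘ₗ p (0 + 1)) = LinearMap.range (i 1) := by
      rw [LinearMap.ker_comp_of_ker_eq_bot _ (LinearMap.ker_eq_bot.mpr (hi 0))]
      exact (hip 1).linearMap_ker_eq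
    exact ⟨(LinearEquiv.ofInjective (i 1) (hi 1)).trans (LinearEquiv.ofEq _ _ h.symm)⟩

/-- `Perp` is closed under syzygies and under cokernels of suitable left approximations, so a chain
can be continued from M in both directions. -/
theorem Perp.isGorensteinProjective [IsNoetherianRing Λ] [IsNoetherianRing Λᵐᵒᵖ] {m : ℕ}
    [HasInjectiveDimensionLT (ModuleCat.of Λᵐᵒᵖ Λ) m] {M : FGModuleCat.{u} Λ} (hM : Perp Λ M) :
    IsGorensteinProjective M := by
  let T := {X : FGModuleCat.{u} Λ // Perp Λ X}
  obtain ⟨X, hX2, hX⟩ := exists_int_chain (fun Y X : T => IsTightSyzygy Y.1 X.1)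
    (fun ⟨X, hX⟩ => by
      obtain ⟨k, π, hπ⟩ := Module.Finite.exists_fin' Λ X
      exact ⟨⟨FGModuleCat.of Λ (LinearMap.ker π), hX.ker hπ⟩, FGModuleCat.of Λ (Fin k → Λ),
        (LinearMap.ker π).subtype, π,
        inferInstanceAs (Module.Projective Λ (Fin k → Λ)), Submodule.subtype_injective _,
        exact_subtype_ker π, hπ,
        hX.isLeftApprox (Submodule.subtype_injective _) (exact_subtype_ker π) hπ⟩)
    (fun ⟨X, hX⟩ => by
      obtain ⟨k, f, hf, happ, hC⟩ := hX.exists_cosyzygy (m := m)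
      exact ⟨⟨FGModuleCat.of Λ ((Fin k → Λ) ⧸ LinearMap.range f), hC⟩, FGModuleCat.of Λ (Fin k → Λ),
        f, (LinearMap.range f).mkQ, inferInstanceAs (Module.Projective Λ (Fin k → Λ)), hf,
        LinearMap.exact_map_mkQ_range f, Submodule.mkQ_surjective _, happ⟩)
    ⟨M, hM⟩ 2
  have := isGorensteinProjective_of_chain (fun m => (X m).1) hX
  rwa [hX2] at this

/-- The kernels in the complex are syzygies of one another. Exactness under Hom(-, Λ) says that
Ext^1 vanishes for every kernel, and shifting gives all degrees. -/
theorem IsGorensteinProjective.perp {M : FGModuleCat.{u} Λ} (hM : IsGorensteinProjective M) :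
    Perp Λ M := by
  obtain ⟨P, d, hP, hd, hQ, ⟨e⟩⟩ := hM
  have hΛ := hQ (FGModuleCat.of Λ Λ) (inferInstanceAs (Module.Projective Λ Λ))
  let p (m : ℤ) : P (m + 1 + 1) →ₗ[Λ] LinearMap.ker (d m) :=
    (d (m + 1)).codRestrict _ fun x => (hd m).apply_apply_eq_zero x
  have hp (m : ℤ) : Function.Surjective (p m) := by
    rintro ⟨x, hx⟩
    obtain ⟨y, rfl⟩ := (hd m x).mp hx
    exact ⟨y, rfl⟩
  have hex (m : ℤ) : Function.Exact (LinearMap.ker (d (m + 1))).subtype (p m) := by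
    intro x
    simp only [Submodule.subtype_apply, Set.mem_range, Subtype.exists, LinearMap.mem_ker,
      exists_prop, exists_eq_right]
    exact Subtype.ext_iff
  have key (i : ℕ) : ∀ m, ExtZero Λ (i + 1) (LinearMap.ker (d m)) Λ := by
    induction i with
    | zero =>
      intro m
      refine .of_exists_extension (Submodule.subtype_injective _) (hex m) (hp m) fun φ => ?_
      -- Pulled back along the surjection onto the kernel, `φ` becomes a cocycle; a bounding cochain
      -- extends `φ`.
      obtain ⟨ψ, hψ⟩ := (hΛ (m + 1 + 1) (φ ∘ₗ p (m + 1))).mp (by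
        ext x
        have : p (m + 1) (d (m + 1 + 1 + 1) x) = 0 :=
          Subtype.ext ((hd (m + 1 + 1)).apply_apply_eq_zero x)
        simp [this])
      refine ⟨ψ, ?_⟩
      ext x
      obtain ⟨y, rfl⟩ := hp (m + 1) x
      exact LinearMap.congr_fun hψ y
    | succ i ih =>
      intro m
      exact (ExtZero.succ_iff (Submodule.subtype_injective _) (hex m) (hp m)).mp (ih (m + 1))
  exact fun i => (key i 0).of_equiv e.symm

theorem ResDimLE.extZero {k : ℕ} {M : FGModuleCat.{u} Λ}
    (h : ResDimLE {X | IsGorensteinProjective X} k M) {i : ℕ} (hi : k ≤ i) :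
    ExtZero Λ (i + 1) M Λ := by
  induction h generalizing i with
  | zero X M hX e => exact (hX.perp i).of_equiv e
  | succ k K X M hX f g hf hfg hg hK ih =>
    obtain ⟨j, rfl⟩ := Nat.exists_eq_add_of_le' hi
    exact (ih (i := j + k) (by omega)).right hf hfg hg (hX.perp _)

theorem extZero_of_gpd_le {k : ℕ} {M : FGModuleCat.{u} Λ} (h : gpd M ≤ k) {i : ℕ} (hi : k ≤ i) :
    ExtZero Λ (i + 1) M Λ := by
  by_contra hne
  have h1 : ((k + 1 : ℕ) : ℕ∞) ≤ gpd M := by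
    refine le_iInf₂ fun l hl => ?_
    rw [Nat.cast_le]
    by_contra hlt
    exact hne (hl.extZero (by omega))
  have := h1.trans h
  rw [Nat.cast_le] at this
  omega

/-- If `Ext^i(M, Λ) = 0` for `i > k` then `M` has Gorenstein projective dimension at most `k`. -/
theorem gpd_le [IsNoetherianRing Λ] [IsNoetherianRing Λᵐᵒᵖ] {m : ℕ}
    [HasInjectiveDimensionLT (ModuleCat.of Λᵐᵒᵖ Λ) m] (k : ℕ) :
    ∀ M : FGModuleCat.{u} Λ, (∀ i, k ≤ i → ExtZero Λ (i + 1) M Λ) → gpd M ≤ k := by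
  suffices h : ∀ M : FGModuleCat.{u} Λ, (∀ i, k ≤ i → ExtZero Λ (i + 1) M Λ) →
      ResDimLE {X | IsGorensteinProjective X} k M from fun M hM => iInf₂_le k (h M hM)
  induction k with
  | zero =>
    intro M hM
    have : Perp Λ M := fun i => hM i (Nat.zero_le _)
    exact .zero M M (this.isGorensteinProjective (m := m)) (LinearEquiv.refl _ _)
  | succ k ih =>
    intro M hM
    obtain ⟨l, π, hπ⟩ := Module.Finite.exists_fin' Λ M
    have hF : Perp Λ (FGModuleCat.of Λ (Fin l → Λ)) :=
      Perp.of_projective (A := Fin l → Λ)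
    exact .succ k (FGModuleCat.of Λ (LinearMap.ker π)) (FGModuleCat.of Λ (Fin l → Λ)) M
      (hF.isGorensteinProjective (m := m)) (LinearMap.ker π).subtype π
      (Submodule.subtype_injective _) (exact_subtype_ker π) hπ
      (ih _ fun i hi => (ExtZero.succ_iff (Submodule.subtype_injective _) (exact_subtype_ker π)
        hπ).mpr (hM (i + 1) (by omega)))

end GorensteinProjective

/-! ### Finite projective dimension and the test module -/

section FinitisticDimension

variable {Λ : Type u} [Ring Λ]

/-- The zero module is harmless here: both `⊥` and its replacement `0` lie below every natural
number. -/
theorem pd_le_iff {M : ModuleCat.{u} Λ} {k : ℕ} :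
    pd M ≤ k ↔ HasProjectiveDimensionLT M (k + 1) := by
  refine Iff.trans ?_ (projectiveDimension_le_iff M k)
  unfold pd
  generalize projectiveDimension M = d
  induction d with
  | bot => simp
  | coe d => exact (WithBot.coe_le_coe (a := d) (b := (k : ℕ∞))).symm

theorem injDim_le_iff {M : ModuleCat.{u} Λ} {k : ℕ} :
    injDim M ≤ k ↔ HasInjectiveDimensionLT M (k + 1) := by
  refine Iff.trans ?_ (injectiveDimension_le_iff M k)
  unfold injDim
  generalize injectiveDimension M = d
  induction d with
  | bot => simp
  | coe d => exact (WithBot.coe_le_coe (a := d) (b := (k : ℕ∞))).symm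

theorem exists_nat_of_ne_top {a : ℕ∞} (h : a ≠ ⊤) : ∃ k : ℕ, a ≤ k :=
  ⟨a.toNat, (ENat.natCast_toNat h).ge⟩

/-- `M` has projective dimension `< k`. -/
def PdLT (Λ : Type u) [Ring Λ] (k : ℕ) (M : Type u) [AddCommGroup M] [Module Λ M] : Prop :=
  HasProjectiveDimensionLT (ModuleCat.of Λ M) k

variable {A B C M : Type u} [AddCommGroup A] [Module Λ A] [AddCommGroup B] [Module Λ B]
  [AddCommGroup C] [Module Λ C] [AddCommGroup M] [Module Λ M]

theorem pdLT_one_iff : PdLT Λ 1 M ↔ Module.Projective Λ M :=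
  projective_iff_hasProjectiveDimensionLT_one.symm.trans (IsProjective.iff_projective M).symm

theorem PdLT.mono {k l : ℕ} (h : PdLT Λ k M) (hkl : k ≤ l) : PdLT Λ l M :=
  have : HasProjectiveDimensionLT (ModuleCat.of Λ M) k := h
  hasProjectiveDimensionLT_of_ge (ModuleCat.of Λ M) k l hkl

theorem PdLT.extZero {k i : ℕ} (h : PdLT Λ k M) (hi : k ≤ i) (N : Type u) [AddCommGroup N]
    [Module Λ N] : ExtZero Λ i M N :=
  have : HasProjectiveDimensionLT (ModuleCat.of Λ M) k := h
  ExtZero.of_hasProjectiveDimensionLT (M := ModuleCat.of Λ M) k hi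

theorem PdLT.succ_iff [Module.Projective Λ B] {f : A →ₗ[Λ] B} {g : B →ₗ[Λ] C}
    (hf : Function.Injective f) (hfg : Function.Exact f g) (hg : Function.Surjective g) {k : ℕ} :
    PdLT Λ (k + 2) C ↔ PdLT Λ (k + 1) A :=
  (shortExact_of hf hfg hg).hasProjectiveDimensionLT_X₃_iff k
    (ModuleCat.projective_of_categoryTheory_projective (ModuleCat.of Λ B))

/-- Syzygies reduce to d = 0. There the kernel of a free cover is a finitely generated projective,
and Ext^1(M, Λ) = 0 extends its identity to the cover, so the cover splits. -/
theorem pdLT_of_extZero [IsNoetherianRing Λ] (d : ℕ) :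
    ∀ (M : Type u) [AddCommGroup M] [Module Λ M] [Module.Finite Λ M], PdLT Λ (d + 2) M →
      ExtZero Λ (d + 1) M Λ → PdLT Λ (d + 1) M := by
  induction d with
  | zero =>
    intro M _ _ _ h hE
    obtain ⟨k, π, hπ⟩ := Module.Finite.exists_fin' Λ M
    have hK := (PdLT.succ_iff (Submodule.subtype_injective _) (exact_subtype_ker π) hπ).mp h
    rw [zero_add, pdLT_one_iff] at hK ⊢
    have happ : IsLeftApprox (LinearMap.ker π).subtype :=
      hE.exists_extension (Submodule.subtype_injective _) (exact_subtype_ker π) hπ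
    obtain ⟨r, hr⟩ := happ.exists_extension LinearMap.id
    -- The complementary projection 1 - r kills the kernel, so it descends to a section of `π`.
    obtain ⟨s, hs⟩ := exists_factor hπ (LinearMap.id - (LinearMap.ker π).subtype ∘ₗ r)
      fun x hx => by
        have := LinearMap.congr_fun hr ⟨x, hx⟩
        simp only [LinearMap.comp_apply, Submodule.subtype_apply, LinearMap.id_apply] at this
        simp [this]
    refine .of_split s π ?_
    ext x
    obtain ⟨y, rfl⟩ := hπ x
    have h1 : s (π y) = y - (r y : Fin k → Λ) := LinearMap.congr_fun hs y
    have h2 : π (r y : Fin k → Λ) = 0 := (r y).2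
    simp [h1, h2]
  | succ d ih =>
    intro M _ _ _ h hE
    obtain ⟨k, π, hπ⟩ := Module.Finite.exists_fin' Λ M
    exact (PdLT.succ_iff (Submodule.subtype_injective _) (exact_subtype_ker π) hπ).mpr
      (ih _ ((PdLT.succ_iff (Submodule.subtype_injective _) (exact_subtype_ker π) hπ).mp h)
        ((ExtZero.succ_iff (Submodule.subtype_injective _) (exact_subtype_ker π) hπ).mpr hE))

theorem PdLT.of_extZero_of_le [IsNoetherianRing Λ] [Module.Finite Λ M] {n : ℕ}
    (hE : ∀ i, n ≤ i → ExtZero Λ (i + 1) M Λ) (k : ℕ) (h : PdLT Λ (n + k + 1) M) :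
    PdLT Λ (n + 1) M := by
  induction k with
  | zero => exact h
  | succ k ih => exact ih (pdLT_of_extZero _ M h (hE _ (by omega)))

/-- The third isomorphism theorem: `range g` is the image of `range c` modulo `range (c ∘ₗ t)`. It
identifies the cokernel of the embedding built below with one known to lie in `Perp`. -/
theorem exists_equiv_quotient_range {L : Type u} [AddCommGroup L] [Module Λ L] (t : A →ₗ[Λ] B)
    (c : B →ₗ[Λ] L) (g : C →ₗ[Λ] L ⧸ LinearMap.range (c ∘ₗ t)) (q : B →ₗ[Λ] C)
    (hq : Function.Surjective q) (hg : ∀ e, g (q e) = (LinearMap.range (c ∘ₗ t)).mkQ (c e)) :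
    Nonempty ((L ⧸ LinearMap.range c) ≃ₗ[Λ]
      ((L ⧸ LinearMap.range (c ∘ₗ t)) ⧸ LinearMap.range g)) := by
  let σ := (LinearMap.range g).mkQ ∘ₗ (LinearMap.range (c ∘ₗ t)).mkQ
  have hσ : Function.Surjective σ :=
    (Submodule.mkQ_surjective _).comp (Submodule.mkQ_surjective _)
  have hker : LinearMap.range c = LinearMap.ker σ := by
    ext x
    simp only [σ, LinearMap.mem_ker, LinearMap.comp_apply]
    rw [← LinearMap.mem_ker, Submodule.ker_mkQ]
    constructor
    · rintro ⟨e, rfl⟩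
      exact ⟨q e, hg e⟩
    · rintro ⟨y, hy⟩
      obtain ⟨e, rfl⟩ := hq y
      rw [hg, ← sub_eq_zero, ← map_sub, ← LinearMap.mem_ker, Submodule.ker_mkQ] at hy
      obtain ⟨z, hz⟩ := hy
      exact ⟨e - t z, by rw [map_sub, ← LinearMap.comp_apply, hz, sub_sub_cancel]⟩
  exact ⟨(Submodule.quotEquivOfEq _ _ hker).trans (σ.quotKerEquivOfSurjective hσ)⟩

/-- A module with `Ext^i(M, Λ) = 0` for `i > k` embeds into a module of projective dimension at
most `k` with cokernel in `Perp`. -/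
theorem exists_embedding_of_extZero [IsNoetherianRing Λ] [IsNoetherianRing Λᵐᵒᵖ] {m : ℕ}
    [HasInjectiveDimensionLT (ModuleCat.of Λᵐᵒᵖ Λ) m] (k : ℕ) :
    ∀ (M : FGModuleCat.{u} Λ), (∀ i, k ≤ i → ExtZero Λ (i + 1) M Λ) →
      ∃ (H : FGModuleCat.{u} Λ) (f : M →ₗ[Λ] H), Function.Injective f ∧ PdLT Λ (k + 1) H ∧
        Perp Λ (H ⧸ LinearMap.range f) := by
  induction k with
  | zero =>
    intro M hM
    have hP : Perp Λ M := fun i => hM i (Nat.zero_le _)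
    obtain ⟨k, f, hf, -, hC⟩ := hP.exists_cosyzygy (m := m)
    exact ⟨FGModuleCat.of Λ (Fin k → Λ), f, hf, pdLT_one_iff.mpr inferInstance, hC⟩
  | succ k ih =>
    intro M hM
    obtain ⟨l, π, hπ⟩ := Module.Finite.exists_fin' Λ M
    obtain ⟨H', j, hj, hpd, hC⟩ := ih (FGModuleCat.of Λ (LinearMap.ker π)) fun i hi =>
      (ExtZero.succ_iff (Submodule.subtype_injective _) (exact_subtype_ker π) hπ).mpr
        (hM (i + 1) (by omega))
    -- `E` is the pushout of Λ^l ← ker π → H'. It is an extension of H'/ker π by Λ^l, hence in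
    -- `Perp`, and an extension of M by H'.
    let r : LinearMap.ker π →ₗ[Λ] (Fin l → Λ) × H' := (LinearMap.ker π).subtype.prod (-j)
    let R := LinearMap.range r
    let E := ((Fin l → Λ) × H') ⧸ R
    have mem_R : ∀ x h, (x, h) ∈ R ↔ ∃ y : LinearMap.ker π, (y : Fin l → Λ) = x ∧ -j y = h :=
      fun x h => ⟨fun ⟨y, hy⟩ => ⟨y, congrArg Prod.fst hy, congrArg Prod.snd hy⟩,
        fun ⟨y, hx, hh⟩ => ⟨y, Prod.ext hx hh⟩⟩
    let a : (Fin l → Λ) →ₗ[Λ] E := R.mkQ ∘ₗ LinearMap.inl Λ (Fin l → Λ) H'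
    let t : H' →ₗ[Λ] E := R.mkQ ∘ₗ LinearMap.inr Λ (Fin l → Λ) H'
    have ha : Function.Injective a := by
      rw [← LinearMap.ker_eq_bot, LinearMap.ker_eq_bot']
      intro x hx
      obtain ⟨y, rfl, hy⟩ := (mem_R x 0).mp ((Submodule.Quotient.mk_eq_zero R).mp hx)
      rw [neg_eq_zero, map_eq_zero_iff _ hj] at hy
      simp [hy]
    have ht : Function.Injective t := by
      rw [← LinearMap.ker_eq_bot, LinearMap.ker_eq_bot']
      intro h hh
      obtain ⟨y, hy, rfl⟩ := (mem_R 0 h).mp ((Submodule.Quotient.mk_eq_zero R).mp hh)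
      have : y = 0 := Subtype.ext hy
      simp [this]
    obtain ⟨b, hb⟩ := exists_factor R.mkQ_surjective
      ((LinearMap.range j).mkQ ∘ₗ LinearMap.snd Λ (Fin l → Λ) H') (by
        rintro ⟨x, h⟩ hx
        obtain ⟨y, rfl, rfl⟩ := (mem_R x h).mp ((Submodule.Quotient.mk_eq_zero R).mp hx)
        simp)
    have hb' : ∀ x h, b (R.mkQ (x, h)) = (LinearMap.range j).mkQ h :=
      fun x h => LinearMap.congr_fun hb (x, h)
    have hbs : Function.Surjective b := by
      intro z
      obtain ⟨h, rfl⟩ := Submodule.mkQ_surjective _ z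
      exact ⟨_, hb' 0 h⟩
    have hab : Function.Exact a b := by
      intro e
      obtain ⟨⟨x, h⟩, rfl⟩ := R.mkQ_surjective e
      rw [hb', ← LinearMap.mem_ker, Submodule.ker_mkQ]
      constructor
      · rintro ⟨y, rfl⟩
        refine ⟨x + y, ?_⟩
        refine (Submodule.Quotient.eq R).mpr ((mem_R _ _).mpr ⟨y, ?_, ?_⟩) <;> simp
      · rintro ⟨z, hz⟩
        obtain ⟨y, hy1, hy2⟩ := (mem_R _ _).mp ((Submodule.Quotient.eq R).mp hz)
        refine ⟨y, ?_⟩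
        simpa using hy2
    have hE : Perp Λ E := fun i =>
      .middle ha hab hbs (.of_projective i) (hC i)
    -- Embed `E` in Λ^w and set H = Λ^w / H'. Then M = E / H' embeds in H with the same cokernel as
    -- E in Λ^w, and pd H is at most one more than the bound for H'.
    obtain ⟨w, c, hc, -, hcC⟩ := hE.exists_cosyzygy (m := m)
    obtain ⟨q, hq⟩ := exists_factor R.mkQ_surjective
      (π ∘ₗ LinearMap.fst Λ (Fin l → Λ) H') (by
        rintro ⟨x, h⟩ hx
        obtain ⟨y, rfl, rfl⟩ := (mem_R x h).mp ((Submodule.Quotient.mk_eq_zero R).mp hx)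
        exact y.2)
    have hq' : ∀ x h, q (R.mkQ (x, h)) = π x := fun x h => LinearMap.congr_fun hq (x, h)
    have hqs : Function.Surjective q := by
      intro z
      obtain ⟨x, rfl⟩ := hπ z
      exact ⟨_, hq' x 0⟩
    have hqt : ∀ e, q e = 0 → ∃ h, t h = e := by
      intro e he
      obtain ⟨⟨x, h⟩, rfl⟩ := R.mkQ_surjective e
      rw [hq'] at he
      -- The pushout relation moves (x, h) to (0, h + j x).
      refine ⟨h + j ⟨x, he⟩, ?_⟩
      refine (Submodule.Quotient.eq R).mpr ((mem_R _ _).mpr ⟨-⟨x, he⟩, ?_, ?_⟩) <;> simp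
    obtain ⟨g, hg⟩ := exists_factor hqs ((LinearMap.range (c ∘ₗ t)).mkQ ∘ₗ c) fun e he => by
      obtain ⟨h, rfl⟩ := hqt e he
      exact (Submodule.Quotient.mk_eq_zero _).mpr ⟨h, rfl⟩
    have hg' : ∀ e, g (q e) = (LinearMap.range (c ∘ₗ t)).mkQ (c e) := LinearMap.congr_fun hg
    obtain ⟨ε⟩ := exists_equiv_quotient_range t c g q hqs hg'
    refine ⟨FGModuleCat.of Λ ((Fin w → Λ) ⧸ LinearMap.range (c ∘ₗ t)), g, ?_, ?_, hcC.of_equiv ε⟩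
    · rw [← LinearMap.ker_eq_bot, LinearMap.ker_eq_bot']
      intro z hz
      obtain ⟨e, rfl⟩ := hqs z
      rw [hg', ← LinearMap.mem_ker, Submodule.ker_mkQ] at hz
      obtain ⟨h, hh⟩ := hz
      rw [← hc hh]
      exact (hq' 0 h).trans (map_zero π)
    · exact (PdLT.succ_iff (hc.comp ht : Function.Injective (c ∘ₗ t))
        (LinearMap.exact_map_mkQ_range _) (Submodule.mkQ_surjective _)).mpr hpd

theorem pdLT_of_pd_ne_top [IsNoetherianRing Λ] {n : ℕ} [HasInjectiveDimensionLT (ModuleCat.of Λ Λ) (n + 1)]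
    {M : FGModuleCat.{u} Λ} (hM : pd M.obj ≠ ⊤) : PdLT Λ (n + 1) M := by
  obtain ⟨k, hk⟩ := exists_nat_of_ne_top hM
  rw [pd_le_iff] at hk
  have hk' : PdLT Λ (k + 1) M := hk
  exact .of_extZero_of_le (fun i hi =>
    .of_hasInjectiveDimensionLT (N := ModuleCat.of Λ Λ) (n + 1) (by omega)) k
    (hk'.mono (by omega))

/-- Cyclic modules Λ/I already test injective dimension, and they are finitely generated. -/
theorem exists_not_extZero {n : ℕ} (h : ¬ HasInjectiveDimensionLT (ModuleCat.of Λ Λ) (n + 1)) :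
    ∃ M : FGModuleCat.{u} Λ, ¬ ExtZero Λ (n + 1) M Λ := by
  by_contra! hne
  exact h (hasInjectiveDimensionLT_of_extZero_quotient n _ fun I => hne (FGModuleCat.of Λ (Λ ⧸ I)))

/-- A module of finite projective dimension with `Ext^{n+1}(H, Λ) ≠ 0`. -/
theorem exists_pdLT_not_extZero [IsNoetherianRing Λ] [IsNoetherianRing Λᵐᵒᵖ] {m n : ℕ}
    [HasInjectiveDimensionLT (ModuleCat.of Λᵐᵒᵖ Λ) m]
    [HasInjectiveDimensionLT (ModuleCat.of Λ Λ) (n + 2)]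
    (h : ¬ HasInjectiveDimensionLT (ModuleCat.of Λ Λ) (n + 1)) :
    ∃ H : FGModuleCat.{u} Λ, PdLT Λ (n + 2) H ∧ ¬ ExtZero Λ (n + 1) H Λ := by
  obtain ⟨M, hM⟩ := exists_not_extZero h
  obtain ⟨H, f, hf, hpd, hC⟩ := exists_embedding_of_extZero (m := m) (n + 1) M fun i hi =>
    .of_hasInjectiveDimensionLT (N := ModuleCat.of Λ Λ) (n + 2) (by omega)
  -- Ext^(n+1)(M, Λ) lies between Ext^(n+1)(H, Λ) and Ext^(n+2) of the cokernel, which is zero.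
  exact ⟨H, hpd, fun hH => hM (hH.left hf (LinearMap.exact_map_mkQ_range f)
    (Submodule.mkQ_surjective _) (hC _))⟩

end FinitisticDimension

/-! ### Iterated syzygies -/

section Syzygies

variable {Λ : Type u} [Ring Λ] [IsArtinianRing Λ]

theorem extZero_syzygy_iff {M : FGModuleCat.{u} Λ} {N : Type u} [AddCommGroup N] [Module Λ N]
    {i : ℕ} : ExtZero Λ (i + 1) (syzygy M) N ↔ ExtZero Λ (i + 2) M N :=
  have := (isProjectiveCover_coverMap M).projective
  ExtZero.succ_iff (Submodule.subtype_injective _) (exact_subtype_ker (coverMap M))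
    (isProjectiveCover_coverMap M).surjective

theorem extZero_iterate_syzygy_iff {N : Type u} [AddCommGroup N] [Module Λ N] {i : ℕ} (k : ℕ) :
    ∀ M : FGModuleCat.{u} Λ,
      ExtZero Λ (i + 1) (syzygy^[k] M : FGModuleCat.{u} Λ) N ↔ ExtZero Λ (i + k + 1) M N := by
  induction k with
  | zero => exact fun M => Iff.rfl
  | succ k ih => exact fun M => (ih (syzygy M)).trans extZero_syzygy_iff

theorem pdLT_syzygy_iff {M : FGModuleCat.{u} Λ} {i : ℕ} :
    PdLT Λ (i + 1) (syzygy M) ↔ PdLT Λ (i + 2) M :=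
  have := (isProjectiveCover_coverMap M).projective
  (PdLT.succ_iff (Submodule.subtype_injective _) (exact_subtype_ker (coverMap M))
    (isProjectiveCover_coverMap M).surjective).symm

theorem pdLT_iterate_syzygy_iff {i : ℕ} (k : ℕ) :
    ∀ M : FGModuleCat.{u} Λ,
      PdLT Λ (i + 1) (syzygy^[k] M : FGModuleCat.{u} Λ) ↔ PdLT Λ (i + k + 1) M := by
  induction k with
  | zero => exact fun M => Iff.rfl
  | succ k ih => exact fun M => (ih (syzygy M)).trans pdLT_syzygy_iff

theorem iterate_syzygyHom_cls (k : ℕ) :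
    ∀ M : FGModuleCat.{u} Λ, (syzygyHom Λ)^[k] (cls M) = cls (syzygy^[k] M) := by
  induction k with
  | zero => exact fun M => rfl
  | succ k ih => exact fun M => by rw [Function.iterate_succ_apply, syzygyHom_cls, ih]; rfl

end Syzygies

/-! ### A partial left inverse of the syzygy endomorphism -/

section CosyzygyHom

variable {Λ : Type u} [Ring Λ]

/-- Dual Schanuel lemma, one half: for left approximations `f`, `g` of the same module, the
cokernel of `(f, g)` is the sum of the target of `f` and the cokernel of `g`. -/
theorem nonempty_coker_prod_equiv {M F G : FGModuleCat.{u} Λ} (hF : Module.Projective Λ F)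
    (f : M →ₗ[Λ] F) {g : M →ₗ[Λ] G} (hg : IsLeftApprox g) :
    Nonempty (((F × G) ⧸ LinearMap.range (f.prod g)) ≃ₗ[Λ] F × (G ⧸ LinearMap.range g)) := by
  obtain ⟨h, hh⟩ := hg.exists_extension f
  -- With f = h ∘ g, shearing by `h` turns (f, g) into (0, g).
  let σ : (F × G) →ₗ[Λ] F × (G ⧸ LinearMap.range g) :=
    (LinearMap.fst Λ F G - h ∘ₗ LinearMap.snd Λ F G).prod
      ((LinearMap.range g).mkQ ∘ₗ LinearMap.snd Λ F G)
  have hσ : Function.Surjective σ := by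
    rintro ⟨x, z⟩
    obtain ⟨y, rfl⟩ := Submodule.mkQ_surjective _ z
    exact ⟨(x + h y, y), by simp [σ]⟩
  have hker : LinearMap.range (f.prod g) = LinearMap.ker σ := by
    ext ⟨x, y⟩
    have h1 : (x, y) ∈ LinearMap.ker σ ↔ x - h y = 0 ∧ ∃ m, g m = y := by
      rw [LinearMap.mem_ker, Prod.ext_iff]
      exact and_congr Iff.rfl (Submodule.Quotient.mk_eq_zero _)
    rw [h1]
    constructor
    · rintro ⟨m, hm⟩
      obtain rfl : f m = x := congrArg Prod.fst hm
      obtain rfl : g m = y := congrArg Prod.snd hm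
      exact ⟨by rw [← hh, LinearMap.comp_apply, sub_self], m, rfl⟩
    · rintro ⟨hx, m, rfl⟩
      refine ⟨m, ?_⟩
      rw [sub_eq_zero] at hx
      rw [hx, ← LinearMap.comp_apply, hh]
      rfl
  exact ⟨(Submodule.quotEquivOfEq _ _ hker).trans (σ.quotKerEquivOfSurjective hσ)⟩

theorem cls_coker_prod {M F G : FGModuleCat.{u} Λ} (hF : Module.Projective Λ F)
    (f : M →ₗ[Λ] F) {g : M →ₗ[Λ] G} (hg : IsLeftApprox g) :
    cls (FGModuleCat.of Λ ((F × G) ⧸ LinearMap.range (f.prod g))) =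
      cls (FGModuleCat.of Λ (G ⧸ LinearMap.range g)) := by
  obtain ⟨e⟩ := nonempty_coker_prod_equiv hF f hg
  rw [cls_eq_add (M := FGModuleCat.of Λ ((F × G) ⧸ LinearMap.range (f.prod g))) (X := F)
    (Y := FGModuleCat.of Λ (G ⧸ LinearMap.range g)) e, cls_projective hF, zero_add]

/-- Both classes equal that of the cokernel of (f, g), up to swapping factors; so the class does not
depend on the approximation. -/
theorem cls_coker_eq {M F G : FGModuleCat.{u} Λ} (hF : Module.Projective Λ F)
    (hG : Module.Projective Λ G) {f : M →ₗ[Λ] F} {g : M →ₗ[Λ] G} (hf : IsLeftApprox f)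
    (hg : IsLeftApprox g) :
    cls (FGModuleCat.of Λ (F ⧸ LinearMap.range f)) =
      cls (FGModuleCat.of Λ (G ⧸ LinearMap.range g)) := by
  rw [← cls_coker_prod hF f hg, ← cls_coker_prod hG g hf]
  refine cls_congr (M := FGModuleCat.of Λ ((G × F) ⧸ LinearMap.range (g.prod f)))
    (N := FGModuleCat.of Λ ((F × G) ⧸ LinearMap.range (f.prod g)))
    (Submodule.Quotient.equiv _ _ (LinearEquiv.prodComm Λ G F) ?_)
  rw [← LinearMap.range_comp]
  rfl

variable [IsNoetherianRing Λᵐᵒᵖ]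

/-- The cokernel of a left approximation by a free module. -/
def cosyzygy (M : FGModuleCat.{u} Λ) : FGModuleCat.{u} Λ :=
  FGModuleCat.of Λ ((Fin (exists_isLeftApprox (Λ := Λ) M).choose → Λ) ⧸
    LinearMap.range (exists_isLeftApprox (Λ := Λ) M).choose_spec.choose)

theorem cls_cosyzygy {M F : FGModuleCat.{u} Λ} (hF : Module.Projective Λ F) {f : M →ₗ[Λ] F}
    (hf : IsLeftApprox f) :
    cls (cosyzygy M) = cls (FGModuleCat.of Λ (F ⧸ LinearMap.range f)) :=
  cls_coker_eq (F := FGModuleCat.of Λ (Fin (exists_isLeftApprox (Λ := Λ) M).choose → Λ))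
    (inferInstanceAs (Module.Projective Λ (Fin _ → Λ))) hF
    (exists_isLeftApprox (Λ := Λ) M).choose_spec.choose_spec hf

theorem cls_cosyzygy_add {M X Y : FGModuleCat.{u} Λ} (e : M ≃ₗ[Λ] X × Y) :
    cls (cosyzygy M) = cls (cosyzygy X) + cls (cosyzygy Y) := by
  obtain ⟨k, f, hf⟩ := exists_isLeftApprox (Λ := Λ) X
  obtain ⟨l, g, hg⟩ := exists_isLeftApprox (Λ := Λ) Y
  let σ := (LinearMap.range f).mkQ.prodMap (LinearMap.range g).mkQ
  have hσ : Function.Surjective σ :=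
    Function.Surjective.prodMap (Submodule.mkQ_surjective _) (Submodule.mkQ_surjective _)
  let a : M →ₗ[Λ] (Fin k → Λ) × (Fin l → Λ) := f.prodMap g ∘ₗ e.toLinearMap
  have ha : IsLeftApprox a := by
    intro φ
    obtain ⟨ψ₁, h₁⟩ := hf (φ ∘ₗ e.symm.toLinearMap ∘ₗ LinearMap.inl Λ X Y)
    obtain ⟨ψ₂, h₂⟩ := hg (φ ∘ₗ e.symm.toLinearMap ∘ₗ LinearMap.inr Λ X Y)
    refine ⟨ψ₁.coprod ψ₂, ?_⟩
    ext m
    obtain ⟨⟨x, y⟩, rfl⟩ := e.symm.surjective m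
    have e₁ : ψ₁ (f x) = φ (e.symm (x, 0)) := LinearMap.congr_fun h₁ x
    have e₂ : ψ₂ (g y) = φ (e.symm (0, y)) := LinearMap.congr_fun h₂ y
    simp only [a, LinearMap.comp_apply, LinearEquiv.coe_coe, LinearEquiv.apply_symm_apply,
      LinearMap.prodMap_apply, LinearMap.coprod_apply, e₁, e₂]
    rw [← map_add, ← map_add]
    simp
  have hker : LinearMap.range a = LinearMap.ker σ := by
    rw [LinearMap.ker_prodMap, Submodule.ker_mkQ, Submodule.ker_mkQ, LinearMap.range_comp,
      LinearEquiv.range, Submodule.map_top, LinearMap.range_prodMap]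
  rw [cls_cosyzygy (F := FGModuleCat.of Λ ((Fin k → Λ) × (Fin l → Λ)))
      (inferInstanceAs (Module.Projective Λ ((Fin k → Λ) × (Fin l → Λ)))) ha,
    cls_cosyzygy (F := FGModuleCat.of Λ (Fin k → Λ))
      (inferInstanceAs (Module.Projective Λ (Fin k → Λ))) hf,
    cls_cosyzygy (F := FGModuleCat.of Λ (Fin l → Λ))
      (inferInstanceAs (Module.Projective Λ (Fin l → Λ))) hg]
  exact cls_eq_add (M := FGModuleCat.of Λ (((Fin k → Λ) × (Fin l → Λ)) ⧸ LinearMap.range a))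
    (X := FGModuleCat.of Λ ((Fin k → Λ) ⧸ LinearMap.range f))
    (Y := FGModuleCat.of Λ ((Fin l → Λ) ⧸ LinearMap.range g))
    ((Submodule.quotEquivOfEq _ _ hker).trans (σ.quotKerEquivOfSurjective hσ))

theorem cls_cosyzygy_projective {P : FGModuleCat.{u} Λ} (hP : Module.Projective Λ P) :
    cls (cosyzygy P) = 0 := by
  rw [cls_cosyzygy hP (f := LinearMap.id) fun φ => ⟨φ, rfl⟩]
  refine cls_projective ?_
  have : Subsingleton (P ⧸ LinearMap.range (LinearMap.id : P →ₗ[Λ] P)) := by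
    rw [LinearMap.range_id]
    infer_instance
  exact inferInstanceAs (Module.Projective Λ (P ⧸ LinearMap.range (LinearMap.id : P →ₗ[Λ] P)))

variable (Λ) in
/-- The endomorphism of `K₀ Λ` sending `[M]` to the class of the cokernel of a left approximation
of `M` by a projective module. -/
def cosyzygyHom : K₀ Λ →+ K₀ Λ :=
  QuotientAddGroup.lift (AddSubgroup.closure (relations Λ))
    (FreeAbelianGroup.lift fun M => cls (cosyzygy M)) (by
      rw [AddSubgroup.closure_le]
      rintro _ (⟨M, X, Y, ⟨e⟩, rfl⟩ | ⟨P, hP, rfl⟩)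
      · rw [SetLike.mem_coe, AddMonoidHom.mem_ker, map_sub, map_sub]
        simp only [FreeAbelianGroup.lift_apply_of]
        rw [cls_cosyzygy_add e]
        abel
      · rw [SetLike.mem_coe, AddMonoidHom.mem_ker, FreeAbelianGroup.lift_apply_of]
        exact cls_cosyzygy_projective hP)

theorem cosyzygyHom_cls (M : FGModuleCat.{u} Λ) : cosyzygyHom Λ (cls M) = cls (cosyzygy M) :=
  FreeAbelianGroup.lift_apply_of _ _

/-- Vanishing of Ext^1(M, Λ) makes the inclusion ΩM → P(M) a left approximation, and its cokernel is
M. -/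
theorem cosyzygyHom_cls_syzygy [IsArtinianRing Λ] {M : FGModuleCat.{u} Λ}
    (hM : ExtZero Λ 1 M Λ) : cosyzygyHom Λ (cls (syzygy M)) = cls M := by
  have hc := isProjectiveCover_coverMap M
  have hi : IsLeftApprox (LinearMap.ker (coverMap M)).subtype :=
    hM.exists_extension (Submodule.subtype_injective _) (exact_subtype_ker _) hc.surjective
  rw [cosyzygyHom_cls, cls_cosyzygy (M := syzygy M) hc.projective hi]
  exact cls_congr
    (M := FGModuleCat.of Λ (cover M ⧸ LinearMap.range (LinearMap.ker (coverMap M)).subtype))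
    ((Submodule.quotEquivOfEq _ _ (Submodule.range_subtype _)).trans
      ((coverMap M).quotKerEquivOfSurjective hc.surjective))

end CosyzygyHom

/-! ### Upper bound for Φ -/

section PhiUpperBound

variable {Λ : Type u} [Ring Λ] [IsArtinianRing Λ]

theorem iterate_syzygyHom_mem {n : ℕ} {X : FGModuleCat.{u} Λ} {H : AddSubgroup (K₀ Λ)}
    (hH : ∀ M : FGModuleCat.{u} Λ, InAdd M X → cls (syzygy^[n] M) ∈ H) {x : K₀ Λ}
    (hx : x ∈ addSubgroupOf X) : (syzygyHom Λ)^[n] x ∈ H := by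
  induction hx using AddSubgroup.closure_induction with
  | mem x hx =>
    obtain ⟨M, -, hM, rfl⟩ := hx
    rw [iterate_syzygyHom_cls]
    exact hH M hM
  | zero => rw [iterate_map_zero]; exact H.zero_mem
  | add x y _ _ hx hy => rw [iterate_map_add]; exact H.add_mem hx hy
  | neg x _ hx => rw [iterate_map_neg]; exact H.neg_mem hx

/-- Surjectivity is automatic. For injectivity, L^m⟨X⟩ lies in the subgroup generated by classes
with Ext^1(-, Λ) = 0, where the cosyzygy endomorphism inverts L. -/
theorem bijOn_syzygyHom [IsNoetherianRing Λᵐᵒᵖ] {m : ℕ}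
    (h : ∀ M : FGModuleCat.{u} Λ, ∀ i, m ≤ i → ExtZero Λ (i + 1) M Λ) (X : FGModuleCat.{u} Λ) :
    Set.BijOn (syzygyHom Λ) ((syzygyHom Λ)^[m] '' addSubgroupOf X)
      ((syzygyHom Λ)^[m + 1] '' addSubgroupOf X) := by
  let H : AddSubgroup (K₀ Λ) :=
    AddSubgroup.closure {c | ∃ M : FGModuleCat.{u} Λ, ExtZero Λ 1 M Λ ∧ c = cls M}
  have hH : ∀ x ∈ H, cosyzygyHom Λ (syzygyHom Λ x) = x := by
    intro x hx
    induction hx using AddSubgroup.closure_induction with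
    | mem x hx =>
      obtain ⟨M, hM, rfl⟩ := hx
      rw [syzygyHom_cls, cosyzygyHom_cls_syzygy hM]
    | zero => simp
    | add x y _ _ hx hy => rw [map_add, map_add, hx, hy]
    | neg x _ hx => rw [map_neg, map_neg, hx]
  refine ⟨?_, ?_, ?_⟩
  · rintro _ ⟨x, hx, rfl⟩
    exact ⟨x, hx, Function.iterate_succ_apply' _ _ _⟩
  · refine Set.LeftInvOn.injOn (f₁' := cosyzygyHom Λ) ?_
    rintro _ ⟨x, hx, rfl⟩
    refine hH _ (iterate_syzygyHom_mem (H := H) (fun M _ =>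
      AddSubgroup.subset_closure ⟨syzygy^[m] M, ?_, rfl⟩) hx)
    exact (extZero_iterate_syzygy_iff (i := 0) m M).mpr (h M (0 + m) (by omega))
  · rintro _ ⟨x, hx, rfl⟩
    exact ⟨_, ⟨x, hx, rfl⟩, (Function.iterate_succ_apply' _ _ _).symm⟩

theorem Phi_le [IsNoetherianRing Λᵐᵒᵖ] {n : ℕ}
    (h : ∀ M : FGModuleCat.{u} Λ, ∀ i, n ≤ i → ExtZero Λ (i + 1) M Λ)
    (X : FGModuleCat.{u} Λ) : Phi X ≤ n :=
  Nat.sInf_le fun _ hm => bijOn_syzygyHom (fun M i hi => h M i (hm.trans hi)) X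

end PhiUpperBound

/-! ### Lengths of stable Hom modules -/

section StableHom

variable (R : Type v) {Λ : Type u} [CommRing R] [Ring Λ] [Algebra R Λ]
variable (N : Type u) [AddCommGroup N] [Module Λ N]
variable (X : Type u) [AddCommGroup X] [Module Λ X] [Module R X] [IsScalarTower R Λ X]
variable (Y : Type u) [AddCommGroup Y] [Module Λ Y] [Module R Y] [IsScalarTower R Λ Y]
variable (Z : Type u) [AddCommGroup Z] [Module Λ Z] [Module R Z] [IsScalarTower R Λ Z]

/-- The linear maps `N → X` that factor through a projective module. -/
def projHom : Submodule R (N →ₗ[Λ] X) :=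
  LinearMap.range (LinearMap.compRight (M := N) R (Finsupp.linearCombination Λ (id : X → X)))

variable {R N X Y Z}

/-- `projHom` only allows factorisations through the canonical free cover of `X`; any map from a
projective lifts to that cover, so nothing is lost. -/
theorem comp_mem_projHom {Q : Type u} [AddCommGroup Q] [Module Λ Q] [Module.Projective Λ Q]
    (h : Q →ₗ[Λ] X) (g : N →ₗ[Λ] Q) : h ∘ₗ g ∈ projHom R N X := by
  obtain ⟨l, hl⟩ := Module.projective_lifting_property
    (Finsupp.linearCombination Λ (id : X → X)) h (Finsupp.linearCombination_id_surjective Λ X)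
  refine ⟨l ∘ₗ g, ?_⟩
  rw [← hl]
  rfl

theorem mem_projHom_postcomp {f : N →ₗ[Λ] X} (hf : f ∈ projHom R N X) (a : X →ₗ[Λ] Y) :
    a ∘ₗ f ∈ projHom R N Y := by
  obtain ⟨g, rfl⟩ := hf
  exact comp_mem_projHom (R := R) (a ∘ₗ Finsupp.linearCombination Λ (id : X → X)) g

theorem projective_of_id_mem_projHom (h : (LinearMap.id : X →ₗ[Λ] X) ∈ projHom R X X) :
    Module.Projective Λ X := by
  obtain ⟨g, hg⟩ := h
  exact .of_split g (Finsupp.linearCombination Λ (id : X → X)) hg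

theorem length_stableHom_prod (e : X ≃ₗ[Λ] Y × Z) :
    Module.length R ((N →ₗ[Λ] X) ⧸ projHom R N X) =
      Module.length R ((N →ₗ[Λ] Y) ⧸ projHom R N Y) +
        Module.length R ((N →ₗ[Λ] Z) ⧸ projHom R N Z) := by
  let a : X →ₗ[Λ] Y := LinearMap.fst Λ Y Z ∘ₗ e.toLinearMap
  let b : X →ₗ[Λ] Z := LinearMap.snd Λ Y Z ∘ₗ e.toLinearMap
  let a' : Y →ₗ[Λ] X := e.symm.toLinearMap ∘ₗ LinearMap.inl Λ Y Z
  let b' : Z →ₗ[Λ] X := e.symm.toLinearMap ∘ₗ LinearMap.inr Λ Y Z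
  let σ : (N →ₗ[Λ] X) →ₗ[R] ((N →ₗ[Λ] Y) ⧸ projHom R N Y) × ((N →ₗ[Λ] Z) ⧸ projHom R N Z) :=
    ((projHom R N Y).mkQ ∘ₗ LinearMap.compRight R a).prod
      ((projHom R N Z).mkQ ∘ₗ LinearMap.compRight R b)
  have hdec : ∀ f : N →ₗ[Λ] X, a' ∘ₗ a ∘ₗ f + b' ∘ₗ b ∘ₗ f = f := by
    intro f
    ext x
    simp only [a, b, a', b', LinearMap.add_apply, LinearMap.comp_apply, LinearEquiv.coe_coe]
    rw [← map_add]
    simp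
  have hσ : Function.Surjective σ := by
    rintro ⟨y, z⟩
    obtain ⟨f, rfl⟩ := Submodule.mkQ_surjective _ y
    obtain ⟨g, rfl⟩ := Submodule.mkQ_surjective _ z
    refine ⟨a' ∘ₗ f + b' ∘ₗ g, ?_⟩
    have h₁ : a ∘ₗ (a' ∘ₗ f + b' ∘ₗ g) = f := by ext x; simp [a, a', b']
    have h₂ : b ∘ₗ (a' ∘ₗ f + b' ∘ₗ g) = g := by ext x; simp [b, a', b']
    exact Prod.ext (congrArg (projHom R N Y).mkQ h₁) (congrArg (projHom R N Z).mkQ h₂)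
  have hker : projHom R N X = LinearMap.ker σ := by
    ext f
    have h1 : f ∈ LinearMap.ker σ ↔ a ∘ₗ f ∈ projHom R N Y ∧ b ∘ₗ f ∈ projHom R N Z := by
      rw [LinearMap.mem_ker, Prod.ext_iff]
      exact and_congr (Submodule.Quotient.mk_eq_zero _) (Submodule.Quotient.mk_eq_zero _)
    rw [h1]
    refine ⟨fun h => ⟨mem_projHom_postcomp h a, mem_projHom_postcomp h b⟩, fun h => ?_⟩
    rw [← hdec f]
    exact add_mem (mem_projHom_postcomp h.1 a') (mem_projHom_postcomp h.2 b')
  rw [← Module.length_prod]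
  exact ((Submodule.quotEquivOfEq _ _ hker).trans (σ.quotKerEquivOfSurjective hσ)).length_eq

theorem length_stableHom_projective [Module.Projective Λ X] :
    Module.length R ((N →ₗ[Λ] X) ⧸ projHom R N X) = 0 := by
  rw [Module.length_eq_zero_iff, Submodule.Quotient.subsingleton_iff, eq_top_iff]
  exact fun f _ => comp_mem_projHom LinearMap.id f

/-- Hom over Λ is an R-submodule of Hom over R between finitely generated modules over an artinian
ring. -/
theorem length_stableHom_ne_top [IsArtinianRing R] [Module.Finite R Λ] [Module.Finite Λ N]
    [Module.Finite Λ X] : Module.length R ((N →ₗ[Λ] X) ⧸ projHom R N X) ≠ ⊤ := by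
  let : Module R N := Module.compHom N (algebraMap R Λ)
  have : IsScalarTower R Λ N := .of_algebraMap_smul fun _ _ => rfl
  have : Module.Finite R N := .trans Λ N
  have : Module.Finite R X := .trans Λ X
  have : IsNoetherian R (N →ₗ[Λ] X) := isNoetherian_of_injective
    (LinearMap.restrictScalarsₗ R Λ N X R) (LinearMap.restrictScalars_injective R)
  have : Module.Finite R (N →ₗ[Λ] X) := inferInstance
  exact Module.length_ne_top

end StableHom

/-! ### Only projectives have class zero -/

section StableClass

variable (R : Type v) {Λ : Type u} [CommRing R] [Ring Λ] [Algebra R Λ]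

/-- The length of the stable Hom module from `N` to `X`. -/
def stableLength (N X : FGModuleCat.{u} Λ) : ℕ∞ :=
  letI : Module R X := Module.compHom X (algebraMap R Λ)
  haveI : IsScalarTower R Λ X := .of_algebraMap_smul fun _ _ => rfl
  Module.length R ((N →ₗ[Λ] X) ⧸ projHom R N X)

theorem stableLength_ne_top [IsArtinianRing R] [Module.Finite R Λ] (N X : FGModuleCat.{u} Λ) : stableLength R N X ≠ ⊤ :=
  letI : Module R X := Module.compHom X (algebraMap R Λ)
  haveI : IsScalarTower R Λ X := .of_algebraMap_smul fun _ _ => rfl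
  length_stableHom_ne_top

theorem stableLength_add (N : FGModuleCat.{u} Λ) {X Y Z : FGModuleCat.{u} Λ} (e : X ≃ₗ[Λ] Y × Z) :
    stableLength R N X = stableLength R N Y + stableLength R N Z :=
  letI : Module R X := Module.compHom X (algebraMap R Λ)
  haveI : IsScalarTower R Λ X := .of_algebraMap_smul fun _ _ => rfl
  letI : Module R Y := Module.compHom Y (algebraMap R Λ)
  haveI : IsScalarTower R Λ Y := .of_algebraMap_smul fun _ _ => rfl
  letI : Module R Z := Module.compHom Z (algebraMap R Λ)
  haveI : IsScalarTower R Λ Z := .of_algebraMap_smul fun _ _ => rfl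
  length_stableHom_prod e

theorem stableLength_projective (N : FGModuleCat.{u} Λ) {X : FGModuleCat.{u} Λ}
    (hX : Module.Projective Λ X) : stableLength R N X = 0 :=
  letI : Module R X := Module.compHom X (algebraMap R Λ)
  haveI : IsScalarTower R Λ X := .of_algebraMap_smul fun _ _ => rfl
  length_stableHom_projective

theorem projective_of_stableLength_eq_zero {X : FGModuleCat.{u} Λ} (h : stableLength R X X = 0) :
    Module.Projective Λ X := by
  let : Module R X := Module.compHom X (algebraMap R Λ)
  have : IsScalarTower R Λ X := .of_algebraMap_smul fun _ _ => rfl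
  have h' : Module.length R ((X →ₗ[Λ] X) ⧸ projHom R X X) = 0 := h
  rw [Module.length_eq_zero_iff, Submodule.Quotient.subsingleton_iff] at h'
  exact projective_of_id_mem_projHom (R := R) (h' ▸ Submodule.mem_top)

/-- The additive function `[X] ↦ stableLength N X` on `K₀ Λ`. -/
def stableLengthHom [IsArtinianRing R] [Module.Finite R Λ] (N : FGModuleCat.{u} Λ) : K₀ Λ →+ ℤ :=
  QuotientAddGroup.lift (AddSubgroup.closure (relations Λ))
    (FreeAbelianGroup.lift fun X => ((stableLength R N X).toNat : ℤ)) (by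
      rw [AddSubgroup.closure_le]
      rintro _ (⟨M, X, Y, ⟨e⟩, rfl⟩ | ⟨P, hP, rfl⟩)
      · rw [SetLike.mem_coe, AddMonoidHom.mem_ker, map_sub, map_sub]
        simp only [FreeAbelianGroup.lift_apply_of]
        rw [stableLength_add R N e,
          ENat.toNat_add (stableLength_ne_top R N X) (stableLength_ne_top R N Y)]
        push_cast
        ring
      · rw [SetLike.mem_coe, AddMonoidHom.mem_ker, FreeAbelianGroup.lift_apply_of,
          stableLength_projective R N hP]
        rfl)

/-- The class of a module vanishes only if the module is projective. -/
theorem projective_of_cls_eq_zero (R : Type v) {Λ : Type u} [CommRing R] [Ring Λ] [Algebra R Λ]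
    [IsArtinianRing R] [Module.Finite R Λ] {X : FGModuleCat.{u} Λ} (h : cls X = 0) :
    Module.Projective Λ X := by
  -- Test X against itself: if its stable endomorphism ring is zero, the identity factors through a
  -- free module.
  have h1 : stableLengthHom R X (cls X) = ((stableLength R X X).toNat : ℤ) :=
    FreeAbelianGroup.lift_apply_of _ _
  rw [h, map_zero, eq_comm, Nat.cast_eq_zero, ENat.toNat_eq_zero] at h1
  exact projective_of_stableLength_eq_zero R (h1.resolve_right (stableLength_ne_top R X X))

end StableClass

/-! ### Lower bound for Φ -/

section PhiLowerBound

variable {Λ : Type u} [Ring Λ]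

theorem InAdd.refl (X : FGModuleCat.{u} Λ) : InAdd X X :=
  ⟨1, FGModuleCat.of Λ PUnit.{u + 1}, ⟨(LinearEquiv.funUnique (Fin 1) Λ X).trans
    (LinearEquiv.prodUnique (R := Λ) (M := X) (M₂ := PUnit.{u + 1})).symm⟩⟩

theorem InAdd.of_equiv_prod {M Y Z X : FGModuleCat.{u} Λ} (h : InAdd M X) (e : M ≃ₗ[Λ] Y × Z) :
    InAdd Y X := by
  obtain ⟨k, W, ⟨f⟩⟩ := h
  exact ⟨k, FGModuleCat.of Λ (Z × W),
    ⟨f.trans ((e.prodCongr (LinearEquiv.refl Λ W)).trans (LinearEquiv.prodAssoc Λ Y Z W))⟩⟩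

variable [IsArtinianRing Λ]

/-- Induction on length, splitting off summands until they are indecomposable; uniqueness of the
decomposition is not needed. -/
theorem cls_mem_addSubgroupOf {X : FGModuleCat.{u} Λ} :
    ∀ M : FGModuleCat.{u} Λ, InAdd M X → cls M ∈ addSubgroupOf X := by
  let len : FGModuleCat.{u} Λ → ℕ∞ := fun P => Module.length Λ P
  intro M
  induction M using (InvImage.wf len (wellFounded_lt (α := ℕ∞))).induction with
  | _ M ih =>
  intro hM
  rcases subsingleton_or_nontrivial M with hs | hn
  · rw [cls_projective (inferInstance : Module.Projective Λ M)]
    exact zero_mem _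
  by_cases hI : IsIndecomposable M
  · exact AddSubgroup.subset_closure ⟨M, hI, hM, rfl⟩
  · have : ∃ p q : Submodule Λ M, IsCompl p q ∧ p ≠ ⊥ ∧ q ≠ ⊥ := by
      by_contra! hne
      refine hI ⟨hn, fun p q hpq => ?_⟩
      by_cases hp : p = ⊥
      · exact Or.inl hp
      · exact Or.inr (hne p q hpq hp)
    obtain ⟨p, q, hpq, hp, hq⟩ := this
    have hpt : p ≠ ⊤ := fun h => hq (by simpa [h] using hpq.inf_eq_bot)
    have hqt : q ≠ ⊤ := fun h => hp (by simpa [h] using hpq.inf_eq_bot)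
    let e : M ≃ₗ[Λ] p × q := (Submodule.prodEquivOfIsCompl p q hpq).symm
    rw [cls_eq_add (M := M) (X := FGModuleCat.of Λ p) (Y := FGModuleCat.of Λ q) e]
    exact add_mem
      (ih (FGModuleCat.of Λ p) (Submodule.length_lt hpt)
        (hM.of_equiv_prod (Y := FGModuleCat.of Λ p) (Z := FGModuleCat.of Λ q) e))
      (ih (FGModuleCat.of Λ q) (Submodule.length_lt hqt)
        (hM.of_equiv_prod (Y := FGModuleCat.of Λ q) (Z := FGModuleCat.of Λ p)
          (e.trans (LinearEquiv.prodComm Λ p q))))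

/-- If `pd X ≤ n + 1` and `Φ(X) ≤ n`, then `[Ω^n X] = 0`. -/
theorem cls_iterate_syzygy_eq_zero [IsNoetherianRing Λᵐᵒᵖ] {n N : ℕ}
    (h : ∀ M : FGModuleCat.{u} Λ, ∀ i, N ≤ i → ExtZero Λ (i + 1) M Λ) {X : FGModuleCat.{u} Λ}
    (hX : PdLT Λ (n + 2) X) (hn : Phi X ≤ n) : cls (syzygy^[n] X) = 0 := by
  -- `Phi` is an `sInf`, so its defining property holds only once the set is known to be nonempty;
  -- `N` is a member.
  have hS : {k : ℕ | ∀ m, k ≤ m → Set.BijOn (syzygyHom Λ) ((syzygyHom Λ)^[m] '' addSubgroupOf X)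
      ((syzygyHom Λ)^[m + 1] '' addSubgroupOf X)}.Nonempty :=
    ⟨N, fun m hm => bijOn_syzygyHom (fun M i hi => h M i (hm.trans hi)) X⟩
  have hinj := (Nat.sInf_mem hS n hn).injOn
  have hpd : PdLT Λ 1 (syzygy^[n + 1] X : FGModuleCat.{u} Λ) :=
    (pdLT_iterate_syzygy_iff (i := 0) (n + 1) X).mpr (hX.mono (by omega))
  rw [← iterate_syzygyHom_cls]
  -- Compare [Ω^n X] with 0: both lie in L^n⟨X⟩, and L kills both because Ω^(n+1) X is projective.
  refine hinj ⟨_, cls_mem_addSubgroupOf X (InAdd.refl X), rfl⟩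
    ⟨0, zero_mem _, iterate_map_zero _ _⟩ ?_
  rw [← Function.iterate_succ_apply' (syzygyHom Λ), iterate_syzygyHom_cls, map_zero]
  exact cls_projective (pdLT_one_iff.mp hpd)

end PhiLowerBound

/-! ### The bounds assembled -/

section Main

variable {Λ : Type u} [Ring Λ]

theorem le_of_not_succ_le {a : ℕ∞} {k : ℕ} (h : ¬ ((k + 1 : ℕ) : ℕ∞) ≤ a) : a ≤ k := by
  rw [not_le, Nat.cast_add, Nat.cast_one] at h
  exact Order.le_of_lt_add_one h

theorem isNoetherianRing_mulOpposite (R : Type v) [CommRing R] [IsNoetherianRing R] [Algebra R Λ]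
    [Module.Finite R Λ] : IsNoetherianRing Λᵐᵒᵖ :=
  have : Module.Finite R Λᵐᵒᵖ := .equiv (MulOpposite.opLinearEquiv R : Λ ≃ₗ[R] Λᵐᵒᵖ)
  IsNoetherianRing.of_finite R Λᵐᵒᵖ

theorem pd_le_iff_pdLT {M : FGModuleCat.{u} Λ} {k : ℕ} : pd M.obj ≤ k ↔ PdLT Λ (k + 1) M :=
  pd_le_iff

variable {n : ℕ}

theorem succ_le_pd {H : FGModuleCat.{u} Λ} (hH : ¬ ExtZero Λ (n + 1) H Λ) :
    ((n + 1 : ℕ) : ℕ∞) ≤ pd H.obj := by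
  by_contra hlt
  exact hH ((pd_le_iff_pdLT.mp (le_of_not_succ_le hlt)).extZero le_rfl Λ)

variable [IsArtinianRing Λ]

theorem finDim_le [HasInjectiveDimensionLT (ModuleCat.of Λ Λ) (n + 1)] : finDim Λ ≤ n :=
  iSup₂_le fun _ _ => iSup_le fun hX => pd_le_iff_pdLT.mpr (pdLT_of_pd_ne_top hX)

theorem Psi_le [IsNoetherianRing Λᵐᵒᵖ] [HasInjectiveDimensionLT (ModuleCat.of Λ Λ) (n + 1)]
    (h : ∀ M : FGModuleCat.{u} Λ, ∀ i, n ≤ i → ExtZero Λ (i + 1) M Λ) (X : FGModuleCat.{u} Λ) :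
    Psi X ≤ n := by
  have hΦ := Phi_le h X
  have hfd : finDimOf {Z | IsSummand Z (syzygy^[Phi X] X)} ≤ ((n - Phi X : ℕ) : ℕ∞) := by
    refine iSup₂_le fun Z ⟨W, ⟨e⟩⟩ => iSup_le fun hZ => pd_le_iff_pdLT.mpr ?_
    -- Finiteness first gives pd Z ≤ n; vanishing of Ext above n - Φ(X), inherited from the syzygy,
    -- then lowers the bound by Φ(X).
    refine .of_extZero_of_le (fun i hi => ?_) (Phi X)
      ((pdLT_of_pd_ne_top (n := n) hZ).mono (by omega))
    exact (((extZero_iterate_syzygy_iff (Phi X) X).mpr (h X _ (by omega))).of_equiv e).of_split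
      (LinearMap.inl Λ Z W) (LinearMap.fst Λ Z W) (by ext; simp)
  calc Psi X ≤ (Phi X : ℕ∞) + ((n - Phi X : ℕ) : ℕ∞) := by unfold Psi; gcongr
    _ = n := by rw [← Nat.cast_add, Nat.add_sub_cancel' hΦ]

theorem succ_le_Phi (R : Type v) [CommRing R] [IsArtinianRing R] [Algebra R Λ] [Module.Finite R Λ]
    [IsNoetherianRing Λᵐᵒᵖ] {N : ℕ}
    (h : ∀ M : FGModuleCat.{u} Λ, ∀ i, N ≤ i → ExtZero Λ (i + 1) M Λ) {H : FGModuleCat.{u} Λ}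
    (hpd : PdLT Λ (n + 2) H) (hH : ¬ ExtZero Λ (n + 1) H Λ) : n + 1 ≤ Phi H := by
  by_contra hlt
  have h0 := projective_of_cls_eq_zero R (cls_iterate_syzygy_eq_zero h hpd (by omega))
  have h1 := (pdLT_iterate_syzygy_iff (i := 0) n H).mp (pdLT_one_iff.mpr h0)
  exact hH (h1.extZero (by omega) Λ)

end Main

end HomDim

end

theorem mainTheorem8 {R : Type v} {Λ : Type u} [CommRing R] [IsArtinianRing R] [Ring Λ] [Algebra R Λ]
    [Module.Finite R Λ] (hΛ : HomDim.IsGorenstein Λ) (n : ℕ)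
    (hn : HomDim.injDim (ModuleCat.of Λ Λ) = n) :
    haveI : IsArtinianRing Λ := IsArtinianRing.of_finite R Λ
    HomDim.finDim Λ = n ∧ HomDim.PhiDim Λ = n ∧ HomDim.PsiDim Λ = n ∧ HomDim.glGpdim Λ = n := by
  open HomDim in
  have hA : IsArtinianRing Λ := IsArtinianRing.of_finite R Λ
  have hop : IsNoetherianRing Λᵐᵒᵖ := isNoetherianRing_mulOpposite R
  have hL : HasInjectiveDimensionLT (ModuleCat.of Λ Λ) (n + 1) := injDim_le_iff.mp hn.le
  -- Only finiteness on the right matters; equality of the two injective dimensions is never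
  -- invoked.
  obtain ⟨m, hm⟩ := exists_nat_of_ne_top hΛ.right_ne_top
  have hR : HasInjectiveDimensionLT (ModuleCat.of Λᵐᵒᵖ Λ) (m + 1) := injDim_le_iff.mp hm
  have hE : ∀ M : FGModuleCat.{u} Λ, ∀ i, n ≤ i → ExtZero Λ (i + 1) M Λ := fun M i hi =>
    .of_hasInjectiveDimensionLT (N := ModuleCat.of Λ Λ) (n + 1) (by omega)
  have hΨ : PsiDim Λ ≤ n := iSup_le (Psi_le hE)
  have hΦΨ : PhiDim Λ ≤ PsiDim Λ := iSup_mono fun X => le_self_add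
  have hG : glGpdim Λ ≤ n := iSup_le fun M => gpd_le (m := m + 1) n M (hE M)
  have hlow : (n : ℕ∞) ≤ finDim Λ ∧ (n : ℕ∞) ≤ PhiDim Λ ∧ (n : ℕ∞) ≤ glGpdim Λ := by
    -- For n = 0 the lower bounds are trivial; otherwise the test module lives in degree n = k + 1.
    rcases n with _ | k
    · simp
    have hk : ¬ HasInjectiveDimensionLT (ModuleCat.of Λ Λ) (k + 1) := by
      rw [← injDim_le_iff, hn, Nat.cast_le]
      omega
    obtain ⟨H, hpd, hH⟩ := exists_pdLT_not_extZero (m := m + 1) hk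
    refine ⟨(succ_le_pd hH).trans ?_, ?_, ?_⟩
    · have hne : pd H.obj ≠ ⊤ :=
        ((pd_le_iff_pdLT.mpr hpd).trans_lt (ENat.natCast_lt_top _)).ne
      exact le_iSup₂_of_le H (Set.mem_univ _) (le_iSup_of_le hne le_rfl)
    · exact le_iSup_of_le H (Nat.cast_le.mpr (succ_le_Phi R hE hpd hH))
    · refine le_iSup_of_le H ?_
      by_contra hlt
      exact hH (extZero_of_gpd_le (le_of_not_succ_le hlt) le_rfl)
  exact ⟨le_antisymm finDim_le hlow.1, le_antisymm (hΦΨ.trans hΨ) hlow.2.1,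
    le_antisymm hΨ (hlow.2.1.trans hΦΨ), le_antisymm hG hlow.2.2⟩
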